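/- Let $D$ be the open unit disc, $s\ge 1$, and let $N_1,\dots,N_s\ge 2$ be pairwise coprime integers; let $\mathcal S$ be the multiplicative monoid generated by them. Let $\mathcal O^1$ be the multiplicative group of nowhere vanishing holomorphic functions $f$ on $D$ with $f(0)=1$; it is uniquely divisible. Let $\mathcal N$ be the Nevanlinna class (holomorphic $f$ on $D$ with $\sup_{0\le r<1}\frac1{2\pi}\int_0^{2\pi}\log^+|f(re^{i\theta})|\,d\theta<\infty$) and $\mathcal N^1=\mathcal N^\times\cap\mathcal O^1$. A singular inner function is a nowhere vanishing holomorphic $\alpha$ on $D$ with $|\alpha|\le1$ whose radial limits exist and have absolute value $1$ almost everywhere on the unit circle. Let $\mathcal I$ be the group of the functions $\alpha/\alpha(0)$, where $\alpha$ is a quotient of two singular inner functions. For a subgroup $\mathcal G\subset\mathcal O^1$ put $$H^0(\mathcal S,\mathcal G)=\Big\{f\in\mathcal G : f(z^N)^N=\prod_{\zeta^N=1}f(\zeta z)\ \text{for all } N\in\mathcal S\Big\},$$ $$Z(\mathcal S,\mathcal G)=\Big\{\alpha\in\mathcal G : \prod_{\zeta^N=1}\alpha(\zeta z)=1\ \text{for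 all } 1\ne N\in\mathcal S\Big\},$$ and let $\mathcal G^{\mathcal S}$ be the subgroup of $\mathcal G$ generated by the functions $m(z^N)$ that lie in $\mathcal G$, with $m\in\mathcal G$ and $1\neq N\in\mathcal S$. Let $X_i$ be the endomorphism $f(z)\mapsto f(z^{N_i})$ of $\mathcal O^1$, and let $e_i$ be the endomorphism that sends $f$ to the unique $N_i$-th root in $\mathcal O^1$ of $z\mapsto\prod_{\zeta^{N_i}=1}f(\zeta z)$. In the endomorphism ring of the abelian group $\mathcal O^1$ (the group law being written exponentially) put $\Phi_{\mathcal S}(f)=f^{\prod_{i=1}^s(1-X_i)}$ and $u^{\Omega_{\mathcal S}}=u^{\prod_{i=1}^s(1-e_i)}$. Finally put $\Psi_{\mathcal S}(\alpha)(z)=\prod_{N\in\mathcal S}\alpha(z^N)$ for $\alpha\in\mathcal O^1$; this product converges locally uniformly on $D$. Then $\mathcal I\subset\mathcal N^1\subset\mathcal O^1$ and: (a) $\Phi_{\mathcal S}$ restricts to an isomorphism $H^0(\mathcal S,\mathcal O^1)\to Z(\mathcal S,\mathcal O^1)$ with inverse $\Psi_{\mathcal S}$. (b) For each of $\mathcal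 G=\mathcal I,\ \mathcal N^1,\ \mathcal O^1$, the map $\Phi_{\mathcal S}$ restricts to an injective homomorphism $H^0(\mathcal S,\mathcal G)\to Z(\mathcal S,\mathcal G)$, and the map $\pi:Z(\mathcal S,\mathcal G)\to\mathcal G/\mathcal G^{\mathcal S}$ induced by the inclusion is an isomorphism with inverse $\pi^{-1}([u])=u^{\Omega_{\mathcal S}}$. (c) The maps $\mathcal I/\mathcal I^{\mathcal S}\to\mathcal N^1/(\mathcal N^1)^{\mathcal S}\to\mathcal O^1/(\mathcal O^1)^{\mathcal S}$ induced by the inclusions are injective, and the maps $\Phi_{\mathcal S}$ and $\pi$ of (b) for the three groups are compatible with the maps induced by the inclusions $\mathcal I\subset\mathcal N^1\subset\mathcal O^1$. (d) $H^0(\mathcal S,\mathcal I)=H^0(\mathcal S,\mathcal N^1)$. -/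

import Mathlib

open scoped Complex.UnitDisc Topology

noncomputable section

namespace CircleFE

/-! ### Holomorphic functions on the unit disc -/

/-- The extension by zero of a function on the unit disc to `ℂ`. It is only ever evaluated at
points of the disc. -/
def extend (f : 𝔻 → ℂ) (z : ℂ) : ℂ :=
  if h : ‖z‖ < 1 then f (Complex.UnitDisc.mk z h) else 0

/-- Holomorphic functions on the open unit disc. -/
def IsHolo (f : 𝔻 → ℂ) : Prop :=
  DifferentiableOn ℂ (extend f) (Metric.ball 0 1)

/-- The Nevanlinna class: holomorphic `f` such that the means of `log⁺ |f|` over the circles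
of radius `r < 1` around `0` are bounded. -/
def IsNevanlinna (f : 𝔻 → ℂ) : Prop :=
  IsHolo f ∧ ∃ C : ℝ, ∀ r : ℝ, 0 ≤ r → r < 1 →
    Real.circleAverage (fun z => Real.posLog ‖extend f z‖) 0 r ≤ C

/-- Inner functions: holomorphic, bounded by `1`, and with radial limits of absolute value `1`
at almost every point `exp (i θ)` of the circle. -/
def IsInner (f : 𝔻 → ℂ) : Prop :=
  IsHolo f ∧ (∀ z, ‖f z‖ ≤ 1) ∧
    ∀ᵐ θ : ℝ ∂(MeasureTheory.volume.restrict (Set.Ico 0 (2 * Real.pi))),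
      ∃ w : ℂ, Filter.Tendsto (fun r : ℝ => extend f (r * Complex.exp (θ * Complex.I)))
        (𝓝[<] 1) (𝓝 w) ∧ ‖w‖ = 1

/-- Singular inner functions: inner functions without zeros in the disc. -/
def IsSingularInner (f : 𝔻 → ℂ) : Prop :=
  IsInner f ∧ ∀ z, f z ≠ 0

lemma extend_of_lt (f : 𝔻 → ℂ) {z : ℂ} (h : ‖z‖ < 1) :
    extend f z = f (Complex.UnitDisc.mk z h) := by
  simp [extend, h]

lemma extend_coe (f : 𝔻 → ℂ) (z : 𝔻) : extend f (z : ℂ) = f z := by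
  rw [extend_of_lt f z.norm_lt_one, Complex.UnitDisc.mk_coe]

lemma extend_mul (f g : 𝔻 → ℂ) : extend (fun z => f z * g z) = fun z => extend f z * extend g z := by
  funext z
  by_cases h : ‖z‖ < 1 <;> simp [extend, h]

lemma isHolo_of_eq {f : 𝔻 → ℂ} (F : ℂ → ℂ) (hF : DifferentiableOn ℂ F (Metric.ball 0 1))
    (h : ∀ z : 𝔻, f z = F z) : IsHolo f := by
  refine hF.congr fun z hz => ?_
  have hz' : ‖z‖ < 1 := by simpa using hz
  rw [extend_of_lt f hz', h, Complex.UnitDisc.coe_mk]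

lemma IsHolo.mul {f g : 𝔻 → ℂ} (hf : IsHolo f) (hg : IsHolo g) :
    IsHolo (fun z => f z * g z) := by
  refine isHolo_of_eq (fun z => extend f z * extend g z) (DifferentiableOn.mul hf hg) fun z => ?_
  simp [extend_coe]

lemma IsHolo.inv {f : 𝔻 → ℂ} (hf : IsHolo f) (h0 : ∀ z, f z ≠ 0) :
    IsHolo (fun z => (f z)⁻¹) := by
  refine isHolo_of_eq (fun z => (extend f z)⁻¹) (DifferentiableOn.inv hf fun z hz => ?_)
    fun z => by simp [extend_coe]
  have hz' : ‖z‖ < 1 := by simpa using hz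
  rw [extend_of_lt f hz']
  exact h0 _

lemma isHolo_one : IsHolo (fun _ => 1) :=
  isHolo_of_eq (fun _ => 1) (differentiableOn_const 1) fun _ => rfl

lemma IsHolo.comp {f : 𝔻 → ℂ} (hf : IsHolo f) (φ : 𝔻 → 𝔻) (F : ℂ → ℂ) (hF : Differentiable ℂ F)
    (h : ∀ z : 𝔻, ((φ z : 𝔻) : ℂ) = F z) : IsHolo (fun z => f (φ z)) := by
  refine isHolo_of_eq (fun z => extend f (F z)) ?_ fun z => by rw [← h, extend_coe]
  refine DifferentiableOn.comp (t := Metric.ball 0 1) hf hF.differentiableOn fun z hz => ?_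
  have hz' : ‖z‖ < 1 := by simpa using hz
  have := (φ (Complex.UnitDisc.mk z hz')).norm_lt_one
  rw [h, Complex.UnitDisc.coe_mk] at this
  simpa using this

/-! ### The groups of functions -/

/-- The group of nowhere vanishing holomorphic functions on the disc with value `1` at `0`. -/
def O1 : Subgroup (𝔻 → ℂˣ) where
  carrier := {f | IsHolo (fun z => (f z : ℂ)) ∧ f 0 = 1}
  mul_mem' := by
    rintro f g ⟨hf, hf0⟩ ⟨hg, hg0⟩
    exact ⟨by simpa using hf.mul hg, by simp [hf0, hg0]⟩
  one_mem' := ⟨by simpa using isHolo_one, rfl⟩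
  inv_mem' := by
    rintro f ⟨hf, hf0⟩
    exact ⟨by simpa using hf.inv fun z => (f z).ne_zero, by simp [hf0]⟩

/-- The complex valued function underlying an element of `O1`. -/
def toFun (f : O1) (z : 𝔻) : ℂ := ((f : 𝔻 → ℂˣ) z : ℂ)

lemma toFun_isHolo (f : O1) : IsHolo (toFun f) := f.2.1

lemma toFun_zero (f : O1) : toFun f 0 = 1 := by
  simp [toFun, f.2.2]

lemma toFun_ne_zero (f : O1) (z : 𝔻) : toFun f z ≠ 0 := Units.ne_zero _

lemma toFun_injective {f g : O1} (h : ∀ z, toFun f z = toFun g z) : f = g :=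
  Subtype.ext (funext fun z => Units.ext (h z))

lemma toFun_mul (f g : O1) : toFun (f * g) = fun z => toFun f z * toFun g z := by
  funext z; simp [toFun]

lemma toFun_inv (f : O1) : toFun f⁻¹ = fun z => (toFun f z)⁻¹ := by
  funext z; simp [toFun]

lemma toFun_one : toFun 1 = fun _ => 1 := by
  funext z; simp [toFun]

lemma toFun_pow (f : O1) (n : ℕ) : toFun (f ^ n) = fun z => toFun f z ^ n := by
  funext z; simp [toFun]

/-- A nowhere vanishing holomorphic function with value `1` at `0`, as an element of `O1`. -/
def ofFun (f : 𝔻 → ℂ) (hf : IsHolo f) (h : ∀ z, f z ≠ 0) (h0 : f 0 = 1) : O1 :=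
  ⟨fun z => Units.mk0 (f z) (h z), by simpa using hf, Units.ext h0⟩

lemma toFun_ofFun (f : 𝔻 → ℂ) (hf : IsHolo f) (h : ∀ z, f z ≠ 0) (h0 : f 0 = 1) :
    toFun (ofFun f hf h h0) = f := rfl

lemma IsNevanlinna.mul {f g : 𝔻 → ℂ} (hf : IsNevanlinna f) (hg : IsNevanlinna g) :
    IsNevanlinna (fun z => f z * g z) := by
  obtain ⟨hf, C, hC⟩ := hf
  obtain ⟨hg, C', hC'⟩ := hg
  refine ⟨hf.mul hg, C + C', fun r hr0 hr1 => ?_⟩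
  have key : ∀ {k : 𝔻 → ℂ}, IsHolo k →
      CircleIntegrable (fun z => Real.posLog ‖extend k z‖) 0 r := by
    intro k hk
    refine ContinuousOn.circleIntegrable hr0 ?_
    refine Real.continuous_posLog.comp_continuousOn
      (ContinuousOn.norm (ContinuousOn.mono hk.continuousOn fun z hz => ?_))
    have : ‖z‖ = r := by simpa using hz
    simpa [this] using hr1
  refine le_trans ?_ (add_le_add (hC r hr0 hr1) (hC' r hr0 hr1))
  rw [← Real.circleAverage_fun_add (key hf) (key hg)]
  refine Real.circleAverage_mono (key (hf.mul hg)) ((key hf).add (key hg)) fun z _ => ?_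
  simp only [extend_mul, norm_mul]
  exact Real.posLog_mul

lemma isNevanlinna_one : IsNevanlinna (fun _ => 1) := by
  refine ⟨isHolo_one, 0, fun r hr0 hr1 => ?_⟩
  rw [Real.circleAverage_congr_sphere (f₂ := fun _ => (0 : ℝ)), Real.circleAverage_const]
  intro z hz
  have : ‖z‖ = r := by simpa [abs_of_nonneg hr0] using hz
  simp [extend_of_lt _ (this ▸ hr1)]

/-- The group of those elements of `O1` which are units of the Nevanlinna class. -/
def N1 : Subgroup O1 where
  carrier := {f | IsNevanlinna (toFun f) ∧ IsNevanlinna (toFun f⁻¹)}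
  mul_mem' := by
    rintro f g ⟨hf, hf'⟩ ⟨hg, hg'⟩
    refine ⟨?_, ?_⟩
    · rw [toFun_mul]; exact hf.mul hg
    · rw [mul_inv, toFun_mul]; exact hf'.mul hg'
  one_mem' := by
    refine ⟨?_, ?_⟩
    · rw [toFun_one]; exact isNevanlinna_one
    · rw [inv_one, toFun_one]; exact isNevanlinna_one
  inv_mem' := by
    rintro f ⟨hf, hf'⟩
    exact ⟨hf', by rwa [inv_inv]⟩

lemma IsSingularInner.mul {f g : 𝔻 → ℂ} (hf : IsSingularInner f) (hg : IsSingularInner g) :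
    IsSingularInner (fun z => f z * g z) := by
  obtain ⟨⟨hf, hf1, hfr⟩, hf0⟩ := hf
  obtain ⟨⟨hg, hg1, hgr⟩, hg0⟩ := hg
  refine ⟨⟨hf.mul hg, fun z => ?_, ?_⟩, fun z => mul_ne_zero (hf0 z) (hg0 z)⟩
  · rw [norm_mul]; exact mul_le_one₀ (hf1 z) (norm_nonneg _) (hg1 z)
  · filter_upwards [hfr, hgr] with θ ⟨w, hw, hw1⟩ ⟨v, hv, hv1⟩
    refine ⟨w * v, ?_, by simp [hw1, hv1]⟩
    rw [extend_mul]
    exact hw.mul hv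

lemma isSingularInner_one : IsSingularInner (fun _ => 1) := by
  refine ⟨⟨isHolo_one, fun z => by simp, Filter.Eventually.of_forall fun θ => ⟨1, ?_, by simp⟩⟩,
    fun z => one_ne_zero⟩
  refine tendsto_const_nhds.congr' ?_
  filter_upwards [Ioo_mem_nhdsLT (show (0 : ℝ) < 1 by norm_num)] with r hr
  rw [extend_of_lt]
  simpa [Complex.norm_exp_ofReal_mul_I, abs_of_pos hr.1] using hr.2

/-- The group of the functions `α / α(0)` where `α` is a quotient of singular inner functions. -/
def SingI : Subgroup O1 where
  carrier := {f | ∃ α₁ α₂ : 𝔻 → ℂ, IsSingularInner α₁ ∧ IsSingularInner α₂ ∧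
    ∀ z, toFun f z = (α₁ z / α₂ z) / (α₁ 0 / α₂ 0)}
  mul_mem' := by
    rintro f g ⟨α₁, α₂, h₁, h₂, h⟩ ⟨β₁, β₂, k₁, k₂, k⟩
    refine ⟨_, _, h₁.mul k₁, h₂.mul k₂, fun z => ?_⟩
    simp only [toFun_mul, h, k]
    field_simp
  one_mem' := ⟨_, _, isSingularInner_one, isSingularInner_one, fun z => by simp [toFun_one]⟩
  inv_mem' := by
    rintro f ⟨α₁, α₂, h₁, h₂, h⟩
    refine ⟨α₂, α₁, h₂, h₁, fun z => ?_⟩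
    simp only [toFun_inv, h]
    field_simp

/-! ### Operations on `O1` -/

/-- Pullback along `φ_n`: the function `N^* f (z) = f (z ^ n)`. -/
def pull (n : ℕ+) : O1 →* O1 where
  toFun f := ⟨fun z => (f : 𝔻 → ℂˣ) (z ^ n),
    (toFun_isHolo f).comp (fun z => z ^ n) (fun z => z ^ (n : ℕ)) (by fun_prop)
      fun z => Complex.UnitDisc.coe_pow z n,
    by
      have : (0 : 𝔻) ^ n = 0 := by simp
      simpa only [this] using f.2.2⟩
  map_one' := rfl
  map_mul' _ _ := rfl

/-- Pullback along the rotation by `ζ`: the function `z ↦ f (ζ z)`. -/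
def rot (ζ : Circle) : O1 →* O1 where
  toFun f := ⟨fun z => (f : 𝔻 → ℂˣ) (ζ • z),
    (toFun_isHolo f).comp (fun z => ζ • z) (fun z => (ζ : ℂ) * z) (by fun_prop)
      fun z => Complex.UnitDisc.coe_circle_smul ζ z,
    by
      have : ζ • (0 : 𝔻) = 0 := by
        apply Complex.UnitDisc.coe_injective
        simp
      simpa only [this] using f.2.2⟩
  map_one' := rfl
  map_mul' _ _ := rfl

/-- The `n`-th roots of unity form a finite set. -/
lemma finite_roots (n : ℕ+) : {ζ : Circle | ζ ^ (n : ℕ) = 1}.Finite := by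
  refine Set.Finite.of_finite_image (f := fun ζ : Circle => (ζ : ℂ)) ?_
    Circle.coe_injective.injOn
  refine (Polynomial.nthRootsFinset (n : ℕ) (1 : ℂ)).finite_toSet.subset ?_
  rintro _ ⟨ζ, hζ, rfl⟩
  have h : ((ζ ^ (n : ℕ) : Circle) : ℂ) = 1 := by rw [show ζ ^ (n : ℕ) = 1 from hζ]; rfl
  simpa [Polynomial.mem_nthRootsFinset n.pos] using h

/-- The action of `Tr_n = ∑_{ζ ^ n = 1} [ζ]`: the function `z ↦ ∏_{ζ ^ n = 1} f (ζ z)`. -/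
def trace (n : ℕ+) : O1 →* O1 :=
  ∏ ζ ∈ (finite_roots n).toFinset, rot ζ

/-- Holomorphic functions on the disc with vanishing derivative are constant. -/
lemma eq_of_deriv_eq_zero {F : ℂ → ℂ} (hF : DifferentiableOn ℂ F (Metric.ball 0 1))
    (h : ∀ z ∈ Metric.ball (0 : ℂ) 1, deriv F z = 0) {z : ℂ} (hz : z ∈ Metric.ball (0 : ℂ) 1) :
    F z = F 0 :=
  Metric.isOpen_ball.is_const_of_deriv_eq_zero (convex_ball _ _).isPreconnected hF h hz
    (Metric.mem_ball_self one_pos)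

/-- Every element of `O1` is the exponential of a holomorphic function vanishing at `0`. -/
lemma exists_log (f : O1) : ∃ g : 𝔻 → ℂ, IsHolo g ∧ g 0 = 0 ∧ ∀ z, Complex.exp (g z) = toFun f z := by
  have hf := toFun_isHolo f
  set F := extend (toFun f) with hFdef
  have hF0 : ∀ z ∈ Metric.ball (0 : ℂ) 1, F z ≠ 0 := fun z hz => by
    have hz' : ‖z‖ < 1 := by simpa using hz
    rw [hFdef, extend_of_lt _ hz']
    exact toFun_ne_zero f _
  have hF' : DifferentiableOn ℂ (deriv F) (Metric.ball 0 1) := hf.deriv Metric.isOpen_ball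
  have hq : DifferentiableOn ℂ (fun z => deriv F z / F z) (Metric.ball 0 1) := hF'.div hf hF0
  obtain ⟨G, hG⟩ := hq.isExactOn_ball
  have hGd : DifferentiableOn ℂ G (Metric.ball 0 1) := fun z hz =>
    (hG z hz).differentiableAt.differentiableWithinAt
  have hconst : ∀ z ∈ Metric.ball (0 : ℂ) 1,
      F z * Complex.exp (-(G z - G 0)) = F 0 * Complex.exp (-(G 0 - G 0)) := by
    intro z hz
    refine eq_of_deriv_eq_zero (F := fun z => F z * Complex.exp (-(G z - G 0)))
      (DifferentiableOn.mul hf ((hGd.sub_const (G 0)).neg.cexp)) (fun w hw => ?_) hz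
    have hFw := (hf.differentiableAt (Metric.isOpen_ball.mem_nhds hw)).hasDerivAt
    have := hFw.mul ((((hG w hw).sub_const (G 0)).neg).cexp)
    refine this.deriv.trans ?_
    have := hF0 w hw
    field_simp
    ring
  refine ⟨fun z => G z - G 0, isHolo_of_eq (fun z => G z - G 0) (hGd.sub_const _) fun _ => rfl,
    by simp, fun z => ?_⟩
  have h1 := hconst z (by simpa using z.norm_lt_one)
  have h2 : F 0 = 1 := by
    have := extend_coe (toFun f) 0
    rw [Complex.UnitDisc.coe_zero] at this
    rw [hFdef, this, toFun_zero]
  rw [h2, Complex.exp_neg, hFdef, extend_coe] at h1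
  simp only [sub_self, neg_zero, Complex.exp_zero, mul_one] at h1
  exact ((mul_inv_eq_one₀ (Complex.exp_ne_zero _)).1 h1).symm

/-- The group `O1` is uniquely divisible. -/
lemma pow_bijective (n : ℕ+) : Function.Bijective (powMonoidHom (n : ℕ) : O1 →* O1) := by
  have hn : (n : ℕ) ≠ 0 := n.ne_zero
  have hn' : ((n : ℕ) : ℂ) ≠ 0 := by exact_mod_cast hn
  constructor
  · rw [injective_iff_map_eq_one]
    intro f hf
    obtain ⟨g, hg, hg0, hgf⟩ := exists_log f
    have hpow : ∀ z, toFun f z ^ (n : ℕ) = 1 := fun z => by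
      have := congrArg (fun k => toFun k z) hf
      simpa [toFun_pow, toFun_one] using this
    have hfh := toFun_isHolo f
    have hc : ∀ z ∈ Metric.ball (0 : ℂ) 1, extend (toFun f) z = extend (toFun f) 0 := by
      intro z hz
      refine eq_of_deriv_eq_zero hfh (fun w hw => ?_) hz
      have hd := hfh.differentiableAt (Metric.isOpen_ball.mem_nhds hw)
      have h1 : HasDerivAt (fun z => extend (toFun f) z ^ (n : ℕ)) 0 w := by
        refine (hasDerivAt_const w (1 : ℂ)).congr_of_eventuallyEq ?_
        filter_upwards [Metric.isOpen_ball.mem_nhds hw] with v hv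
        have hv' : ‖v‖ < 1 := by simpa using hv
        rw [extend_of_lt _ hv', hpow]
      have h2 := (hd.hasDerivAt.pow (n : ℕ)).unique h1
      have h3 : extend (toFun f) w ≠ 0 := by
        have hw' : ‖w‖ < 1 := by simpa using hw
        rw [extend_of_lt _ hw']
        exact toFun_ne_zero f _
      rcases mul_eq_zero.1 h2 with h | h
      · exact absurd h (mul_ne_zero hn' (pow_ne_zero _ h3))
      · exact h
    refine toFun_injective fun z => ?_
    have := hc z (by simpa using z.norm_lt_one)
    rw [extend_coe, ← Complex.UnitDisc.coe_zero, extend_coe, toFun_zero] at this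
    rw [this, toFun_one]
  · intro f
    obtain ⟨g, hg, hg0, hgf⟩ := exists_log f
    refine ⟨ofFun (fun z => Complex.exp (g z / n))
      (isHolo_of_eq (fun z => Complex.exp (extend g z / n))
        ((DifferentiableOn.div_const hg _).cexp) fun z => by rw [extend_coe])
      (fun z => Complex.exp_ne_zero _) (by simp [hg0]), toFun_injective fun z => ?_⟩
    rw [powMonoidHom_apply, toFun_pow, toFun_ofFun, ← hgf z]
    change Complex.exp (g z / n) ^ (n : ℕ) = _
    rw [← Complex.exp_nat_mul]
    congr 1
    field_simp

/-- The unique `n`-th root in `O1`. -/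
def root (n : ℕ+) : O1 →* O1 :=
  (MulEquiv.ofBijective (powMonoidHom (n : ℕ) : O1 →* O1) (pow_bijective n)).symm.toMonoidHom

/-- The action of `e_n = n⁻¹ Tr_n`: the unique `n`-th root in `O1` of
`z ↦ ∏_{ζ ^ n = 1} f (ζ z)`. -/
def idem (n : ℕ+) : O1 →* O1 := (root n).comp (trace n)

/-- The endomorphism ring of the abelian group `O1`, written additively. Multiplication is
composition. -/
abbrev EndO1 : Type := AddMonoid.End (Additive O1)

/-- An endomorphism of the multiplicative group `O1` as an element of the endomorphism ring. -/
def toEnd (f : O1 →* O1) : EndO1 := MonoidHom.toAdditive f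

/-- An element of the endomorphism ring as an endomorphism of the multiplicative group `O1`. -/
def act (T : EndO1) : O1 →* O1 := MonoidHom.toAdditive.symm T

/-- `Φ_S = ∏ i, (1 - X_i)` acting on `O1`, where `X_i` acts as pullback along `z ↦ z ^ N_i`.
The factors commute. -/
def Phi {s : ℕ} (N : Fin s → ℕ+) : O1 →* O1 :=
  act (List.ofFn fun i => 1 - toEnd (pull (N i))).prod

/-- `Ω_S = ∏ i, (1 - e_i)` acting on `O1`, where `e_i = N_i⁻¹ Tr_{N_i}`. The factors commute. -/
def Omega {s : ℕ} (N : Fin s → ℕ+) : O1 →* O1 :=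
  act (List.ofFn fun i => 1 - toEnd (idem (N i))).prod

/-- The multiplicative monoid generated by the numbers `N_i`. -/
def mon {s : ℕ} (N : Fin s → ℕ+) : Submonoid ℕ+ := Submonoid.closure (Set.range N)

/-- The infinite product `Ψ_S(α)(z) = ∏_{n ∈ S} α (z ^ n)`. -/
def Psi (S : Submonoid ℕ+) (α : O1) (z : 𝔻) : ℂ := ∏' n : S, toFun α (z ^ (n : ℕ+))

/-- `H⁰(S, G)`: the `f ∈ G` with `f (z ^ n) ^ n = ∏_{ζ ^ n = 1} f (ζ z)` for all `n ∈ S`. -/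
def H0 (S : Submonoid ℕ+) (G : Subgroup O1) : Subgroup O1 where
  carrier := {f | f ∈ G ∧ ∀ n ∈ S, pull n f ^ (n : ℕ) = trace n f}
  mul_mem' := by
    rintro f g ⟨hf, hf'⟩ ⟨hg, hg'⟩
    exact ⟨mul_mem hf hg, fun n hn => by rw [map_mul, map_mul, mul_pow, hf' n hn, hg' n hn]⟩
  one_mem' := ⟨one_mem _, fun n _ => by simp⟩
  inv_mem' := by
    rintro f ⟨hf, hf'⟩
    exact ⟨inv_mem hf, fun n hn => by rw [map_inv, map_inv, inv_pow, hf' n hn]⟩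

/-- `Z(S, G)`: the `α ∈ G` with `∏_{ζ ^ n = 1} α (ζ z) = 1` for all `n ∈ S`, `n ≠ 1`. -/
def Z (S : Submonoid ℕ+) (G : Subgroup O1) : Subgroup O1 where
  carrier := {α | α ∈ G ∧ ∀ n ∈ S, n ≠ 1 → trace n α = 1}
  mul_mem' := by
    rintro f g ⟨hf, hf'⟩ ⟨hg, hg'⟩
    exact ⟨mul_mem hf hg, fun n hn h1 => by rw [map_mul, hf' n hn h1, hg' n hn h1, one_mul]⟩
  one_mem' := ⟨one_mem _, fun n _ _ => map_one _⟩
  inv_mem' := by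
    rintro f ⟨hf, hf'⟩
    exact ⟨inv_mem hf, fun n hn h1 => by rw [map_inv, hf' n hn h1, inv_one]⟩

lemma Z_le (S : Submonoid ℕ+) (G : Subgroup O1) : Z S G ≤ G := fun _ h => h.1

/-- `G^S`: the subgroup of `G` generated by the functions `m (z ^ n)` with `m ∈ G` and
`1 ≠ n ∈ S`. -/
def powS (S : Submonoid ℕ+) (G : Subgroup O1) : Subgroup G :=
  Subgroup.closure {g | ∃ n ∈ S, n ≠ 1 ∧ ∃ m : G, (g : O1) = pull n m}

/-- The map `π : Z(S, G) → G / G^S` induced by the inclusion of `Z(S, G)` in `G`. -/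
def proj (S : Submonoid ℕ+) (G : Subgroup O1) : Z S G →* G ⧸ powS S G :=
  (QuotientGroup.mk' (powS S G)).comp (Subgroup.inclusion (Z_le S G))

/-- The map `G / G^S → H / H^S` induced by an inclusion `G ≤ H`. -/
def quotMap (S : Submonoid ℕ+) {G H : Subgroup O1} (h : G ≤ H) :
    G ⧸ powS S G →* H ⧸ powS S H :=
  QuotientGroup.map (powS S G) (powS S H) (Subgroup.inclusion h) <| by
    rw [powS, Subgroup.closure_le]
    rintro g ⟨n, hn, h1, m, hm⟩
    exact Subgroup.subset_closure ⟨n, hn, h1, Subgroup.inclusion h m, hm⟩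

end CircleFE

end

open scoped Complex.UnitDisc
open CircleFE

open scoped Complex.UnitDisc
open CircleFE

namespace CircleFE

open MeasureTheory Filter

/-! ### Power series on the disc -/

/-! Every `f` in `O1` is `exp (∑ a_k z ^ k)` for a unique sequence with `a_0 = 0` that converges on
the disc (`logCoeff`). On these sequences every operation is arithmetic of indices: `pull n` moves
`a_k` to index `n * k`, `idem n` keeps the multiples of `n`, and `trace n` keeps them with a factor
`n`. So `H0` means `a_{N_i k} = a_k`, `Z` means that `a_k` vanishes as soon as some `N_i` divides
`k`, and `Omega` is the projection that erases exactly those coefficients.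

For (a): on `H0` the operators `Phi` and `Omega` agree, by coprimality
(`listOp_pull_eq_listOp_idem`). A sequence in `H0` is determined by its values at indices divisible
by no `N_i`, since any other positive index can be reduced to a smaller one (`Phi_injOn`). `Psi`
spreads these values back along the orbits of the monoid (`tsum_logCoeff_pull_mul`,
`exists_Phi_eq`).

For (b) and (c): `idem n u` is a function of `z ^ n`, so `u` and `Omega u` differ by a product of
pullbacks, while `Omega` kills pullbacks. This works inside any subgroup stable under pullback,
`idem` and descent along `z ↦ z ^ n` (`IsAdmissible`). For `N1` the stability follows from
invariance of circle means; for `SingI` it is convenient to work with bounded functions whose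
modulus has a constant radial limit (`IsSingularWith`).

For (d): if `f` lies in `N1`, then `log |f|` is a difference of Poisson integrals of finite measures
(`exists_poisson_representation`), and by Fatou's theorem (`ae_tendsto_poisson`) its radial limit
`h` is `2π` times the density of that difference. The functional equation passes to `h` and says
that the Fourier coefficients of `h` at `m` and `n * m` agree; iterating, the Riemann-Lebesgue lemma
forces them to vanish for `m ≠ 0`. Hence the absolutely continuous part contributes only a constant,
and the singular parts give quotients of singular inner functions
(`mem_SingI_of_functional_equation`). -/

lemma summable_norm_of_summable_disc {a : ℕ → ℂ} (ha : ∀ z : 𝔻, Summable fun k => a k * (z : ℂ) ^ k)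
    {r : ℝ} (hr0 : 0 ≤ r) (hr : r < 1) : Summable fun k => ‖a k‖ * r ^ k := by
  have hz : ‖(r : ℂ)‖ < 1 := by simpa [abs_of_nonneg hr0] using hr
  have := (ha (Complex.UnitDisc.mk r hz)).norm
  simpa [abs_of_nonneg hr0] using this

lemma hasFPowerSeriesOnBall_of_summable {a : ℕ → ℂ}
    (ha : ∀ z : 𝔻, Summable fun k => a k * (z : ℂ) ^ k) :
    HasFPowerSeriesOnBall (fun z => ∑' k, a k * z ^ k)
      (FormalMultilinearSeries.ofScalars ℂ a) 0 1 := by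
  have hrad : 1 ≤ (FormalMultilinearSeries.ofScalars ℂ a).radius := by
    refine ENNReal.le_of_forall_nnreal_lt fun r hr => ?_
    refine FormalMultilinearSeries.le_radius_of_summable_norm _ ?_
    simp only [FormalMultilinearSeries.ofScalars_norm]
    exact summable_norm_of_summable_disc ha r.2 (by exact_mod_cast hr)
  have h := (FormalMultilinearSeries.ofScalars ℂ a).hasFPowerSeriesOnBall
    (lt_of_lt_of_le one_pos hrad)
  refine (h.mono one_pos hrad).congr fun z _ => ?_
  simp [FormalMultilinearSeries.sum, mul_comm]

lemma differentiableOn_of_summable {a : ℕ → ℂ}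
    (ha : ∀ z : 𝔻, Summable fun k => a k * (z : ℂ) ^ k) :
    DifferentiableOn ℂ (fun z => ∑' k, a k * z ^ k) (Metric.ball 0 1) := by
  have := (hasFPowerSeriesOnBall_of_summable ha).differentiableOn
  rwa [show (1 : ENNReal) = ENNReal.ofReal 1 by simp, Metric.eball_ofReal] at this

lemma exists_series {g : 𝔻 → ℂ} (hg : IsHolo g) :
    ∃ a : ℕ → ℂ, ∀ z : 𝔻, HasSum (fun k => a k * (z : ℂ) ^ k) (g z) := by
  refine ⟨fun k => (k.factorial : ℂ)⁻¹ * iteratedDeriv k (extend g) 0, fun z => ?_⟩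
  have := Complex.hasSum_taylorSeries_on_ball hg (z := z) (by simpa using z.norm_lt_one)
  rw [extend_coe] at this
  refine this.congr_fun fun k => ?_
  simp only [sub_zero, smul_eq_mul]
  ring

/-! ### Logarithmic coefficients -/

/-- `a` is the sequence of Taylor coefficients of the logarithm of `f` vanishing at `0`. -/
def LogSeries (f : O1) (a : ℕ → ℂ) : Prop :=
  a 0 = 0 ∧ ∀ z : 𝔻, ∃ S, HasSum (fun k => a k * (z : ℂ) ^ k) S ∧ Complex.exp S = toFun f z

lemma LogSeries.summable {f : O1} {a : ℕ → ℂ} (h : LogSeries f a) (z : 𝔻) :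
    Summable fun k => a k * (z : ℂ) ^ k :=
  let ⟨_, hS, _⟩ := h.2 z
  hS.summable

lemma LogSeries.exp_tsum {f : O1} {a : ℕ → ℂ} (h : LogSeries f a) (z : 𝔻) :
    Complex.exp (∑' k, a k * (z : ℂ) ^ k) = toFun f z := by
  obtain ⟨S, hS, hf⟩ := h.2 z
  rw [hS.tsum_eq, hf]

lemma logSeries_of_summable {f : O1} {a : ℕ → ℂ} (h0 : a 0 = 0)
    (h : ∀ z : 𝔻, Summable fun k => a k * (z : ℂ) ^ k)
    (hf : ∀ z : 𝔻, Complex.exp (∑' k, a k * (z : ℂ) ^ k) = toFun f z) : LogSeries f a :=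
  ⟨h0, fun z => ⟨_, (h z).hasSum, hf z⟩⟩

lemma exists_logSeries (f : O1) : ∃ a, LogSeries f a := by
  obtain ⟨g, hg, hg0, hgf⟩ := exists_log f
  obtain ⟨a, ha⟩ := exists_series hg
  refine ⟨a, ?_, fun z => ⟨g z, ha z, hgf z⟩⟩
  have h := ha 0
  rw [hg0] at h
  have h2 := hasSum_single (f := fun k => a k * ((0 : 𝔻) : ℂ) ^ k) 0
    (fun k hk => by simp [hk])
  have := h2.unique h
  simpa using this

lemma LogSeries.injective {f g : O1} {a : ℕ → ℂ} (hf : LogSeries f a) (hg : LogSeries g a) :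
    f = g :=
  toFun_injective fun z => by rw [← hf.exp_tsum, hg.exp_tsum]

/-- Together with injectivity this lets elements of `O1` be built from coefficients; both the
descent along `z ↦ z ^ n` and the product `Psi` are obtained this way. -/
lemma exists_of_summable {a : ℕ → ℂ} (h0 : a 0 = 0)
    (h : ∀ z : 𝔻, Summable fun k => a k * (z : ℂ) ^ k) : ∃ f, LogSeries f a := by
  have h00 : ∑' k, a k * (0 : ℂ) ^ k = 0 := by
    rw [tsum_eq_single 0 (fun k hk => by simp [hk])]
    simp [h0]
  refine ⟨ofFun (fun z => Complex.exp (∑' k, a k * (z : ℂ) ^ k)) (isHolo_of_eq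
    (fun z => Complex.exp (∑' k, a k * z ^ k)) (differentiableOn_of_summable h).cexp
    fun z => rfl) (fun z => Complex.exp_ne_zero _) (by simp [h00]),
    logSeries_of_summable h0 h fun z => rfl⟩

lemma LogSeries.mul {f g : O1} {a b : ℕ → ℂ} (hf : LogSeries f a) (hg : LogSeries g b) :
    LogSeries (f * g) (a + b) := by
  refine ⟨by simp [hf.1, hg.1], fun z => ?_⟩
  obtain ⟨S, hS, hSf⟩ := hf.2 z
  obtain ⟨T, hT, hTg⟩ := hg.2 z
  refine ⟨S + T, ?_, by rw [Complex.exp_add, hSf, hTg, toFun_mul]⟩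
  convert hS.add hT using 2 with k
  rw [Pi.add_apply, add_mul]

lemma LogSeries.inv {f : O1} {a : ℕ → ℂ} (hf : LogSeries f a) : LogSeries f⁻¹ (-a) := by
  refine ⟨by simp [hf.1], fun z => ?_⟩
  obtain ⟨S, hS, hSf⟩ := hf.2 z
  refine ⟨-S, ?_, by rw [Complex.exp_neg, hSf, toFun_inv]⟩
  exact hS.neg.congr_fun fun k => by simp

lemma LogSeries.div {f g : O1} {a b : ℕ → ℂ} (hf : LogSeries f a) (hg : LogSeries g b) :
    LogSeries (f / g) (a - b) := by
  rw [div_eq_mul_inv, sub_eq_add_neg]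
  exact hf.mul hg.inv

lemma logSeries_one : LogSeries 1 0 :=
  ⟨rfl, fun z => ⟨0, by simp, by simp [toFun_one]⟩⟩

/-- Differentiating `exp s = 1` gives `s' = 0`, so `s` is constant, and a power series of the zero
function has zero coefficients. This makes the logarithmic coefficients independent of choices. -/
lemma LogSeries.eq_zero {a : ℕ → ℂ} (h : LogSeries 1 a) : a = 0 := by
  set s : ℂ → ℂ := fun z => ∑' k, a k * z ^ k with hs
  have hd : DifferentiableOn ℂ s (Metric.ball 0 1) := differentiableOn_of_summable h.summable
  have hexp : ∀ z ∈ Metric.ball (0 : ℂ) 1, Complex.exp (s z) = 1 := by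
    intro z hz
    have hz' : ‖z‖ < 1 := by simpa using hz
    simpa [toFun_one] using h.exp_tsum (Complex.UnitDisc.mk z hz')
  have hs0 : s 0 = 0 := by
    change ∑' k, a k * (0 : ℂ) ^ k = 0
    rw [tsum_eq_single 0 (fun k hk => by simp [hk])]
    simp [h.1]
  have hconst : ∀ z ∈ Metric.ball (0 : ℂ) 1, s z = 0 := by
    intro z hz
    rw [← hs0]
    refine eq_of_deriv_eq_zero hd (fun w hw => ?_) hz
    have hsw := (hd.differentiableAt (Metric.isOpen_ball.mem_nhds hw)).hasDerivAt
    have h1 : HasDerivAt (fun z => Complex.exp (s z)) 0 w := by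
      refine (hasDerivAt_const w (1 : ℂ)).congr_of_eventuallyEq ?_
      filter_upwards [Metric.isOpen_ball.mem_nhds hw] with v hv using hexp v hv
    have h2 := hsw.cexp.unique h1
    simpa using h2
  have hp := hasFPowerSeriesOnBall_of_summable h.summable
  have h0 : HasFPowerSeriesAt (0 : ℂ → ℂ) (FormalMultilinearSeries.ofScalars ℂ a) 0 := by
    refine hp.hasFPowerSeriesAt.congr ?_
    filter_upwards [Metric.isOpen_ball.mem_nhds (Metric.mem_ball_self (x := (0 : ℂ)) one_pos)]
      with z hz using hconst z hz
  exact (FormalMultilinearSeries.ofScalars_series_eq_zero ℂ).1 h0.eq_zero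

lemma LogSeries.unique {f : O1} {a b : ℕ → ℂ} (ha : LogSeries f a) (hb : LogSeries f b) :
    a = b := by
  have := ha.div hb
  rw [div_self'] at this
  exact sub_eq_zero.1 this.eq_zero

/-- The Taylor coefficients of the logarithm of `f` vanishing at `0`. -/
noncomputable def logCoeff (f : O1) : ℕ → ℂ := (exists_logSeries f).choose

lemma logSeries_logCoeff (f : O1) : LogSeries f (logCoeff f) := (exists_logSeries f).choose_spec

lemma LogSeries.logCoeff_eq {f : O1} {a : ℕ → ℂ} (h : LogSeries f a) : logCoeff f = a :=
  (logSeries_logCoeff f).unique h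

lemma logCoeff_injective : Function.Injective logCoeff := fun f g h =>
  (logSeries_logCoeff f).injective (h ▸ logSeries_logCoeff g)

lemma logCoeff_zero (f : O1) : logCoeff f 0 = 0 := (logSeries_logCoeff f).1

lemma logCoeff_one : logCoeff 1 = 0 := logSeries_one.logCoeff_eq

lemma logCoeff_mul (f g : O1) : logCoeff (f * g) = logCoeff f + logCoeff g :=
  ((logSeries_logCoeff f).mul (logSeries_logCoeff g)).logCoeff_eq

lemma logCoeff_div (f g : O1) : logCoeff (f / g) = logCoeff f - logCoeff g :=
  ((logSeries_logCoeff f).div (logSeries_logCoeff g)).logCoeff_eq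

/-- Taking logarithmic coefficients, as a homomorphism. -/
noncomputable def logCoeffHom : O1 →* Multiplicative (ℕ → ℂ) where
  toFun f := Multiplicative.ofAdd (logCoeff f)
  map_one' := by rw [logCoeff_one]; rfl
  map_mul' f g := by rw [logCoeff_mul]; rfl

lemma logCoeff_pow (f : O1) (n : ℕ) : logCoeff (f ^ n) = n • logCoeff f := by
  have := map_pow logCoeffHom f n
  exact congrArg Multiplicative.toAdd this

lemma logCoeff_prod {ι : Type*} (s : Finset ι) (f : ι → O1) :
    logCoeff (∏ i ∈ s, f i) = ∑ i ∈ s, logCoeff (f i) := by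
  have := map_prod logCoeffHom f s
  exact congrArg Multiplicative.toAdd this

lemma toFun_pull (n : ℕ+) (f : O1) (z : 𝔻) : toFun (pull n f) z = toFun f (z ^ n) := rfl

lemma toFun_rot (ζ : Circle) (f : O1) (z : 𝔻) : toFun (rot ζ f) z = toFun f (ζ • z) := rfl

lemma logCoeff_pull (n : ℕ+) (f : O1) :
    logCoeff (pull n f) = fun k => if (n : ℕ) ∣ k then logCoeff f (k / n) else 0 := by
  refine LogSeries.logCoeff_eq ⟨by simp [logCoeff_zero], fun z => ?_⟩
  obtain ⟨S, hS, hSf⟩ := (logSeries_logCoeff f).2 (z ^ n)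
  refine ⟨S, ?_, by rw [hSf, toFun_pull]⟩
  have hinj : Function.Injective fun k : ℕ => (n : ℕ) * k :=
    fun a b h => Nat.eq_of_mul_eq_mul_left n.pos h
  rw [← hinj.hasSum_iff]
  · convert hS using 2 with k
    simp [pow_mul]
  · intro k hk
    have : ¬ (n : ℕ) ∣ k := fun ⟨m, hm⟩ => hk ⟨m, hm.symm⟩
    simp [this]

lemma logCoeff_rot (ζ : Circle) (f : O1) :
    logCoeff (rot ζ f) = fun k => (ζ : ℂ) ^ k * logCoeff f k := by
  refine LogSeries.logCoeff_eq ⟨by simp [logCoeff_zero], fun z => ?_⟩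
  obtain ⟨S, hS, hSf⟩ := (logSeries_logCoeff f).2 (ζ • z)
  refine ⟨S, ?_, by rw [hSf, toFun_rot]⟩
  convert hS using 2 with k
  rw [Complex.UnitDisc.coe_circle_smul]
  ring

lemma sum_roots_pow (n : ℕ+) (k : ℕ) :
    ∑ ζ ∈ (finite_roots n).toFinset, (ζ : ℂ) ^ k = if (n : ℕ) ∣ k then (n : ℂ) else 0 := by
  have hprim := Complex.isPrimitiveRoot_exp (n : ℕ) n.ne_zero
  have himg : ∑ ζ ∈ (finite_roots n).toFinset, (ζ : ℂ) ^ k =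
      ∑ w ∈ Polynomial.nthRootsFinset (n : ℕ) (1 : ℂ), w ^ k := by
    refine Finset.sum_bij (fun ζ _ => (ζ : ℂ)) ?_ ?_ ?_ ?_
    · intro ζ hζ
      have h : ζ ^ (n : ℕ) = 1 := by simpa using hζ
      rw [Polynomial.mem_nthRootsFinset n.pos, ← Circle.coe_pow, h, Circle.coe_one]
    · intro a _ b _ h
      exact Circle.coe_injective h
    · intro w hw
      rw [Polynomial.mem_nthRootsFinset n.pos] at hw
      have hn : ‖w‖ = 1 := Complex.norm_eq_one_of_pow_eq_one hw n.ne_zero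
      obtain ⟨ζ, rfl⟩ : ∃ ζ : Circle, (ζ : ℂ) = w := ⟨⟨w, mem_sphere_zero_iff_norm.2 hn⟩, rfl⟩
      refine ⟨ζ, ?_, rfl⟩
      rw [Set.Finite.mem_toFinset]
      exact Circle.coe_injective hw
    · intro _ _; rfl
  rw [himg]
  have hbij : ∑ w ∈ Polynomial.nthRootsFinset (n : ℕ) (1 : ℂ), w ^ k =
      ∑ i ∈ Finset.range n, (Complex.exp (2 * Real.pi * Complex.I / (n : ℕ)) ^ i) ^ k := by
    symm
    refine Finset.sum_bij (fun i _ => Complex.exp (2 * Real.pi * Complex.I / (n : ℕ)) ^ i)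
      ?_ ?_ ?_ ?_
    · intro i _
      rw [Polynomial.mem_nthRootsFinset n.pos, ← pow_mul, mul_comm i, pow_mul, hprim.pow_eq_one,
        one_pow]
    · intro i hi j hj h
      exact hprim.pow_inj (Finset.mem_range.1 hi) (Finset.mem_range.1 hj) h
    · intro w hw
      rw [Polynomial.mem_nthRootsFinset n.pos] at hw
      obtain ⟨i, hi, h⟩ := hprim.eq_pow_of_pow_eq_one hw
      exact ⟨i, Finset.mem_range.2 hi, h⟩
    · intro _ _; rfl
  rw [hbij]
  set ζ := Complex.exp (2 * Real.pi * Complex.I / (n : ℕ)) with hζ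
  -- A geometric sum with ratio `ζ ^ k`: the ratio is `1` when `n ∣ k`, and otherwise the numerator
  -- `(ζ ^ k) ^ n - 1` vanishes.
  simp_rw [← pow_mul, mul_comm _ k, pow_mul]
  split_ifs with hdvd
  · rw [(hprim.pow_eq_one_iff_dvd k).2 hdvd]
    simp
  · have hne : ζ ^ k ≠ 1 := fun h => hdvd ((hprim.pow_eq_one_iff_dvd k).1 h)
    have := geom_sum_eq hne n
    rw [this, ← pow_mul, mul_comm, pow_mul, hprim.pow_eq_one, one_pow, sub_self, zero_div]

lemma trace_apply (n : ℕ+) (f : O1) :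
    trace n f = ∏ ζ ∈ (finite_roots n).toFinset, rot ζ f := by
  rw [trace, MonoidHom.finsetProd_apply]

lemma logCoeff_trace (n : ℕ+) (f : O1) :
    logCoeff (trace n f) = fun k => if (n : ℕ) ∣ k then n * logCoeff f k else 0 := by
  funext k
  rw [trace_apply, logCoeff_prod, Finset.sum_apply]
  simp_rw [logCoeff_rot]
  rw [← Finset.sum_mul, sum_roots_pow]
  split_ifs <;> simp

lemma root_pow (n : ℕ+) (f : O1) : root n f ^ (n : ℕ) = f :=
  (MulEquiv.ofBijective (powMonoidHom (n : ℕ) : O1 →* O1) (pow_bijective n)).apply_symm_apply f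

lemma logCoeff_idem (n : ℕ+) (f : O1) :
    logCoeff (idem n f) = fun k => if (n : ℕ) ∣ k then logCoeff f k else 0 := by
  have h : logCoeff (idem n f ^ (n : ℕ)) = logCoeff (trace n f) :=
    congrArg logCoeff (root_pow n (trace n f))
  rw [logCoeff_pow, logCoeff_trace] at h
  funext k
  have hk := congrFun h k
  have hn : ((n : ℕ) : ℂ) ≠ 0 := by exact_mod_cast n.ne_zero
  simp only [Pi.smul_apply, nsmul_eq_mul] at hk
  split_ifs with hd
  · rw [if_pos hd] at hk
    exact mul_left_cancel₀ hn hk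
  · rw [if_neg hd] at hk
    simpa using hk

lemma idem_pow (n : ℕ+) (f : O1) : idem n f ^ (n : ℕ) = trace n f := root_pow n _

/-! ### The groups `H⁰` and `Z` in terms of logarithmic coefficients -/

/-- Both sides have logarithms supported on multiples of `n`, and the exponent `n` on the left
cancels the factor `n` produced by summing over the roots of unity. -/
lemma pull_pow_eq_trace_iff (n : ℕ+) (f : O1) :
    pull n f ^ (n : ℕ) = trace n f ↔ ∀ k, logCoeff f (n * k) = logCoeff f k := by
  have hn : ((n : ℕ) : ℂ) ≠ 0 := by exact_mod_cast n.ne_zero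
  rw [← logCoeff_injective.eq_iff, logCoeff_pow, logCoeff_pull, logCoeff_trace]
  constructor
  · intro h k
    have := congrFun h (n * k)
    simp only [Pi.smul_apply, dvd_mul_right, if_true, nsmul_eq_mul,
      Nat.mul_div_cancel_left k n.pos] at this
    exact (mul_left_cancel₀ hn this).symm
  · intro h
    funext k
    simp only [Pi.smul_apply, nsmul_eq_mul]
    split_ifs with hd
    · obtain ⟨j, rfl⟩ := hd
      rw [Nat.mul_div_cancel_left j n.pos, h]
    · simp

lemma trace_eq_one_iff (n : ℕ+) (f : O1) :
    trace n f = 1 ↔ ∀ k, (n : ℕ) ∣ k → logCoeff f k = 0 := by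
  have hn : ((n : ℕ) : ℂ) ≠ 0 := by exact_mod_cast n.ne_zero
  rw [← logCoeff_injective.eq_iff, logCoeff_one, logCoeff_trace, funext_iff]
  refine forall_congr' fun k => ?_
  by_cases hd : (n : ℕ) ∣ k <;> simp [hd]

lemma pull_injective (n : ℕ+) : Function.Injective (pull n) := by
  intro f g h
  refine logCoeff_injective (funext fun k => ?_)
  have := congrFun (congrArg logCoeff h) (n * k)
  simpa [logCoeff_pull] using this

lemma exists_pow_eq_disc (n : ℕ+) (z : 𝔻) : ∃ w : 𝔻, w ^ n = z := by
  obtain ⟨w, hw⟩ := IsAlgClosed.exists_pow_nat_eq (z : ℂ) n.pos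
  have hw1 : ‖w‖ < 1 := by
    by_contra! h
    have h1 : 1 ≤ ‖w‖ ^ (n : ℕ) := one_le_pow₀ h
    rw [← norm_pow, hw] at h1
    exact absurd z.norm_lt_one (not_lt.2 h1)
  exact ⟨Complex.UnitDisc.mk w hw1, Complex.UnitDisc.coe_injective hw⟩

/-- The logarithm of `idem n f` contains only powers of `z ^ n`. Convergence of the descended series
at `z` is checked at an `n`-th root `w` of `z`, where it is a subseries of the logarithm of `f`. -/
lemma exists_pull_eq_idem (n : ℕ+) (f : O1) : ∃ m, pull n m = idem n f := by
  obtain ⟨m, hm⟩ := exists_of_summable (a := fun k => logCoeff f (n * k))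
    (by simp [logCoeff_zero]) fun z => by
      obtain ⟨w, rfl⟩ := exists_pow_eq_disc n z
      have hinj : Function.Injective fun k : ℕ => (n : ℕ) * k :=
        fun a b h => Nat.eq_of_mul_eq_mul_left n.pos h
      refine (((logSeries_logCoeff f).summable w).comp_injective hinj).congr fun k => ?_
      simp [pow_mul]
  refine ⟨m, logCoeff_injective ?_⟩
  rw [logCoeff_pull, logCoeff_idem, hm.logCoeff_eq]
  funext k
  simp only
  split_ifs with hd
  · rw [Nat.mul_div_cancel' hd]
  · rfl

/-! ### The operators `Φ` and `Ω` -/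

lemma act_one_sub_apply (φ : O1 →* O1) (f : O1) : act (1 - toEnd φ) f = f / φ f := rfl

lemma act_mul_apply (A B : EndO1) (f : O1) : act (A * B) f = act A (act B f) := rfl

/-- The composition of the endomorphisms `1 - φ n` for `n` in a list. -/
noncomputable def listOp (φ : ℕ+ → O1 →* O1) (l : List ℕ+) : O1 →* O1 :=
  act (l.map fun n => 1 - toEnd (φ n)).prod

lemma listOp_nil (φ : ℕ+ → O1 →* O1) (f : O1) : listOp φ [] f = f := rfl

lemma listOp_cons (φ : ℕ+ → O1 →* O1) (n : ℕ+) (l : List ℕ+) (f : O1) :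
    listOp φ (n :: l) f = listOp φ l f / φ n (listOp φ l f) := by
  rw [listOp, List.map_cons, List.prod_cons, act_mul_apply, act_one_sub_apply]
  rfl

lemma Phi_eq_listOp {s : ℕ} (N : Fin s → ℕ+) : Phi N = listOp pull (List.ofFn N) := by
  rw [Phi, listOp, List.map_ofFn]
  rfl

lemma Omega_eq_listOp {s : ℕ} (N : Fin s → ℕ+) : Omega N = listOp idem (List.ofFn N) := by
  rw [Omega, listOp, List.map_ofFn]
  rfl

lemma listOp_mem {G : Subgroup O1} {φ : ℕ+ → O1 →* O1} (h : ∀ n, ∀ f ∈ G, φ n f ∈ G)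
    (l : List ℕ+) {f : O1} (hf : f ∈ G) : listOp φ l f ∈ G := by
  induction l with
  | nil => rwa [listOp_nil]
  | cons n l ih => rw [listOp_cons]; exact div_mem ih (h n _ ih)

open Classical in
lemma logCoeff_listOp_idem (l : List ℕ+) (f : O1) :
    logCoeff (listOp idem l f) = fun k => if ∃ n ∈ l, (n : ℕ) ∣ k then 0 else logCoeff f k := by
  induction l with
  | nil => funext k; simp [listOp_nil]
  | cons n l ih =>
    funext k
    rw [listOp_cons, logCoeff_div, logCoeff_idem, Pi.sub_apply, ih]
    by_cases hn : (n : ℕ) ∣ k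
    · simp [hn]
    · simp [hn]

/-- For `g = listOp idem l f` and `n` coprime to the members of `l`, the index condition `m ∣ n * k`
is the same as `m ∣ k`, so erasing coefficients for `l` preserves the invariance under `n`. That
invariance turns the shift `pull n g` into the projection `idem n g`. -/
lemma listOp_pull_eq_listOp_idem {l : List ℕ+} (hl : l.Pairwise fun m n => m.Coprime n) {f : O1}
    (hf : ∀ n ∈ l, ∀ k, logCoeff f (n * k) = logCoeff f k) :
    listOp pull l f = listOp idem l f := by
  induction l with
  | nil => rfl
  | cons n l ih =>
    rw [List.pairwise_cons] at hl
    have ih' := ih hl.2 fun m hm => hf m (List.mem_cons_of_mem _ hm)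
    rw [listOp_cons, listOp_cons, ih']
    congr 1
    refine logCoeff_injective (funext fun k => ?_)
    rw [logCoeff_pull, logCoeff_idem, logCoeff_listOp_idem]
    simp only
    split_ifs with hd h1 h2 h2 <;> try rfl
    · obtain ⟨m, hm, hmk⟩ := h1
      exact absurd ⟨m, hm, hmk.trans (Nat.div_dvd_of_dvd hd)⟩ h2
    · obtain ⟨j, rfl⟩ := hd
      rw [Nat.mul_div_cancel_left j n.pos] at h1
      obtain ⟨m, hm, hmk⟩ := h2
      have hc : (m : ℕ).Coprime n := (PNat.coprime_coe.2 (hl.1 m hm)).symm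
      exact absurd ⟨m, hm, hc.dvd_of_dvd_mul_left hmk⟩ h1
    · obtain ⟨j, rfl⟩ := hd
      rw [Nat.mul_div_cancel_left j n.pos, hf n List.mem_cons_self]

/-! ### Reduction of conditions over the monoid to its generators `N_i` -/

section Generators

variable {s : ℕ} {N : Fin s → ℕ+}

lemma mem_mon (N : Fin s → ℕ+) (i : Fin s) : N i ∈ mon N :=
  Submonoid.subset_closure ⟨i, rfl⟩

lemma exists_dvd_of_mem_mon {n : ℕ+} (hn : n ∈ mon N) (h1 : n ≠ 1) :
    ∃ i, ∃ m ∈ mon N, n = N i * m := by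
  induction hn using Submonoid.closure_induction_left with
  | one => exact absurd rfl h1
  | mul_left x hx y hy _ =>
    obtain ⟨i, rfl⟩ := hx
    exact ⟨i, y, hy, rfl⟩

/-- The `N_i` need not be prime, so failure of `N i ∣ n` alone would not give coprimality; it does
here because `n` is a product of pairwise coprime generators. -/
lemma coprime_or_exists_of_mem_mon (hcop : Pairwise fun i j => (N i).Coprime (N j)) (i : Fin s)
    {n : ℕ+} (hn : n ∈ mon N) : (N i : ℕ).Coprime n ∨ ∃ m ∈ mon N, n = N i * m := by
  induction hn using Submonoid.closure_induction_left with
  | one => left; simp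
  | mul_left x hx y hy ih =>
    obtain ⟨j, rfl⟩ := hx
    by_cases hij : i = j
    · subst hij
      exact Or.inr ⟨y, hy, rfl⟩
    · rcases ih with h | ⟨m, hm, rfl⟩
      · left
        rw [PNat.mul_coe]
        exact Nat.Coprime.mul_right (PNat.coprime_coe.2 (hcop hij)) h
      · exact Or.inr ⟨N j * m, mul_mem (mem_mon N j) hm, by rw [mul_left_comm]⟩

/-- Invariances of the coefficients under two multipliers compose to invariance under their product,
so the generators suffice. -/
lemma mem_H0_iff {G : Subgroup O1} {f : O1} :
    f ∈ H0 (mon N) G ↔ f ∈ G ∧ ∀ i k, logCoeff f (N i * k) = logCoeff f k := by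
  change (f ∈ G ∧ ∀ n ∈ mon N, pull n f ^ (n : ℕ) = trace n f) ↔ _
  simp_rw [pull_pow_eq_trace_iff]
  refine and_congr_right fun _ => ⟨fun h i => h _ (mem_mon N i), fun h n hn => ?_⟩
  induction hn using Submonoid.closure_induction_left with
  | one => intro k; simp
  | mul_left x hx y hy ih =>
    obtain ⟨i, rfl⟩ := hx
    intro k
    rw [PNat.mul_coe, mul_assoc, h, ih]

/-- Every `n ≠ 1` in the monoid is a multiple of a generator, so vanishing on multiples of
generators is the strongest of the conditions. -/
lemma mem_Z_iff (hN : ∀ i, 2 ≤ N i) {G : Subgroup O1} {f : O1} :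
    f ∈ Z (mon N) G ↔ f ∈ G ∧ ∀ i k, (N i : ℕ) ∣ k → logCoeff f k = 0 := by
  change (f ∈ G ∧ ∀ n ∈ mon N, n ≠ 1 → trace n f = 1) ↔ _
  simp_rw [trace_eq_one_iff]
  refine and_congr_right fun _ => ⟨fun h i => h _ (mem_mon N i) ?_, fun h n hn h1 k hk => ?_⟩
  · rintro h1
    have := hN i
    rw [h1] at this
    exact absurd this (by decide)
  · obtain ⟨i, m, -, rfl⟩ := exists_dvd_of_mem_mon hn h1
    rw [PNat.mul_coe] at hk
    exact h i k ((Dvd.intro _ rfl).trans hk)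

open Classical in
lemma logCoeff_Omega (f : O1) :
    logCoeff (Omega N f) = fun k => if ∃ i, (N i : ℕ) ∣ k then 0 else logCoeff f k := by
  rw [Omega_eq_listOp, logCoeff_listOp_idem]
  simp [List.mem_ofFn]

lemma Phi_eq_Omega (hcop : Pairwise fun i j => (N i).Coprime (N j)) {f : O1}
    (hf : ∀ i k, logCoeff f (N i * k) = logCoeff f k) : Phi N f = Omega N f := by
  rw [Phi_eq_listOp, Omega_eq_listOp]
  refine listOp_pull_eq_listOp_idem ?_ ?_
  · rw [List.pairwise_ofFn]
    exact fun i j hij => hcop hij.ne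
  · intro n hn
    obtain ⟨i, rfl⟩ := (List.mem_ofFn' N n).1 hn
    exact hf i

lemma Omega_mem_Z (hN : ∀ i, 2 ≤ N i) {f : O1} : Omega N f ∈ Z (mon N) ⊤ := by
  refine (mem_Z_iff hN).2 ⟨Subgroup.mem_top _, fun i k hk => ?_⟩
  rw [logCoeff_Omega]
  exact if_pos ⟨i, hk⟩

lemma Omega_eq_self (hN : ∀ i, 2 ≤ N i) {G : Subgroup O1} {f : O1} (hf : f ∈ Z (mon N) G) :
    Omega N f = f := by
  refine logCoeff_injective (funext fun k => ?_)
  rw [logCoeff_Omega]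
  simp only
  split_ifs with h
  · obtain ⟨i, hi⟩ := h
    exact (((mem_Z_iff hN).1 hf).2 i k hi).symm
  · rfl

lemma Omega_pull {n : ℕ+} (hn : n ∈ mon N) (h1 : n ≠ 1) (f : O1) : Omega N (pull n f) = 1 := by
  refine logCoeff_injective (funext fun k => ?_)
  rw [logCoeff_Omega, logCoeff_pull, logCoeff_one]
  simp only [Pi.zero_apply, ite_eq_left_iff, ite_eq_right_iff]
  rintro h hk
  obtain ⟨i, m, -, rfl⟩ := exists_dvd_of_mem_mon hn h1
  rw [PNat.mul_coe] at hk
  exact absurd ⟨i, (Dvd.intro _ rfl).trans hk⟩ h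

/-- `Omega` retains the coefficients at indices divisible by no `N i`. Any other nonzero index `N i
* j` carries the coefficient of the smaller index `j`, so strong induction recovers the rest. -/
lemma Phi_injOn (hN : ∀ i, 2 ≤ N i) (hcop : Pairwise fun i j => (N i).Coprime (N j)) {f g : O1}
    (hf : ∀ i k, logCoeff f (N i * k) = logCoeff f k)
    (hg : ∀ i k, logCoeff g (N i * k) = logCoeff g k) (h : Phi N f = Phi N g) : f = g := by
  rw [Phi_eq_Omega hcop hf, Phi_eq_Omega hcop hg] at h
  refine logCoeff_injective (funext fun k => ?_)
  induction k using Nat.strong_induction_on with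
  | _ k ih =>
    by_cases hk : ∃ i, (N i : ℕ) ∣ k
    · obtain ⟨i, j, rfl⟩ := hk
      rw [hf, hg]
      rcases Nat.eq_zero_or_pos j with rfl | hj
      · rw [logCoeff_zero, logCoeff_zero]
      · have h2 : 2 ≤ (N i : ℕ) := by exact_mod_cast hN i
        exact ih j (by nlinarith)
    · have := congrFun (congrArg logCoeff h) k
      rw [logCoeff_Omega, logCoeff_Omega] at this
      simpa only [if_neg hk] using this

end Generators

/-! ### The infinite product `Ψ` -/

/-- For `k ≥ 1` one has `n * k ≥ (n - 1) + k`, and `a 0 = 0` disposes of `k = 0`. The factor `R ^ (n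
- 1)` is the geometric decay that makes the product over `n` converge. -/
lemma norm_mul_pow_mul_le {a : ℕ → ℂ} (h0 : a 0 = 0) {R : ℝ} (hR0 : 0 ≤ R) (hR1 : R ≤ 1) (n : ℕ+)
    (k : ℕ) : ‖a k‖ * R ^ ((n : ℕ) * k) ≤ R ^ ((n : ℕ) - 1) * (‖a k‖ * R ^ k) := by
  rcases Nat.eq_zero_or_pos k with rfl | hk
  · simp [h0]
  · rw [mul_left_comm, ← pow_add]
    refine mul_le_mul_of_nonneg_left (pow_le_pow_of_le_one hR0 hR1 ?_) (norm_nonneg _)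
    obtain ⟨m, hm⟩ : ∃ m, (n : ℕ) = m + 1 := ⟨(n : ℕ) - 1, (Nat.sub_add_cancel n.pos).symm⟩
    rw [hm, Nat.add_sub_cancel, add_mul, one_mul]
    exact Nat.add_le_add_right (Nat.le_mul_of_pos_right _ hk) _

lemma summable_pow_pred (S : Submonoid ℕ+) {R : ℝ} (hR0 : 0 ≤ R) (hR1 : R < 1) (C : ℝ) :
    Summable fun n : S => R ^ (((n : ℕ+) : ℕ) - 1) * C := by
  have hinj : Function.Injective fun n : S => ((n : ℕ+) : ℕ) - 1 := by
    intro a b h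
    have ha := (a : ℕ+).pos
    have hb := (b : ℕ+).pos
    simp only at h
    exact Subtype.ext (PNat.eq (by omega))
  exact ((summable_geometric_of_lt_one hR0 hR1).comp_injective hinj).mul_right C

lemma summable_norm_pow_mul {f : O1} {a : ℕ → ℂ} (h : LogSeries f a) {R : ℝ} (hR0 : 0 ≤ R)
    (hR1 : R < 1) (n : ℕ+) : Summable fun k => ‖a k‖ * R ^ ((n : ℕ) * k) :=
  ((summable_norm_of_summable_disc h.summable hR0 hR1).mul_left _).of_nonneg_of_le
    (fun _ => by positivity) (norm_mul_pow_mul_le h.1 hR0 hR1.le n)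

lemma tsum_norm_pow_mul_le {f : O1} {a : ℕ → ℂ} (h : LogSeries f a) {R : ℝ} (hR0 : 0 ≤ R)
    (hR1 : R < 1) (n : ℕ+) : ∑' k, ‖a k‖ * R ^ ((n : ℕ) * k) ≤
      R ^ ((n : ℕ) - 1) * ∑' k, ‖a k‖ * R ^ k := by
  rw [← tsum_mul_left]
  exact (summable_norm_pow_mul h hR0 hR1 n).tsum_le_tsum (norm_mul_pow_mul_le h.1 hR0 hR1.le n)
    ((summable_norm_of_summable_disc h.summable hR0 hR1).mul_left _)

lemma norm_tsum_pow_le {f : O1} {a : ℕ → ℂ} (h : LogSeries f a) {R : ℝ} (hR0 : 0 ≤ R)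
    (hR1 : R < 1) (n : ℕ+) {z : 𝔻} (hz : ‖(z : ℂ)‖ ≤ R) :
    ‖∑' k, a k * ((z ^ n : 𝔻) : ℂ) ^ k‖ ≤ R ^ ((n : ℕ) - 1) * ∑' k, ‖a k‖ * R ^ k := by
  refine le_trans (tsum_of_norm_bounded (summable_norm_pow_mul h hR0 hR1 n).hasSum fun k => ?_)
    (tsum_norm_pow_mul_le h hR0 hR1 n)
  rw [norm_mul, Complex.UnitDisc.coe_pow, ← pow_mul, norm_pow]
  gcongr

lemma hasProdUniformlyOn_Psi (S : Submonoid ℕ+) {f : O1} {a : ℕ → ℂ} (h : LogSeries f a) {R : ℝ}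
    (hR0 : 0 ≤ R) (hR1 : R < 1) :
    HasProdUniformlyOn (fun (n : S) (z : 𝔻) => toFun f (z ^ (n : ℕ+)))
      (fun z => Complex.exp (∑' n : S, ∑' k, a k * ((z ^ (n : ℕ+) : 𝔻) : ℂ) ^ k))
      {z : 𝔻 | ‖(z : ℂ)‖ ≤ R} := by
  have hu := summable_pow_pred S hR0 hR1 (∑' k, ‖a k‖ * R ^ k)
  have ht := tendstoUniformlyOn_tsum hu
    (f := fun (n : S) (z : 𝔻) => ∑' k, a k * ((z ^ (n : ℕ+) : 𝔻) : ℂ) ^ k)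
    (s := {z : 𝔻 | ‖(z : ℂ)‖ ≤ R}) fun n z hz => norm_tsum_pow_le h hR0 hR1 n hz
  -- Uniform convergence survives composition with `exp` only where real parts stay bounded above.
  have hb : BddAbove ((fun z : 𝔻 => (∑' n : S, ∑' k, a k * ((z ^ (n : ℕ+) : 𝔻) : ℂ) ^ k).re) ''
      {z : 𝔻 | ‖(z : ℂ)‖ ≤ R}) := by
    refine ⟨∑' n : S, R ^ (((n : ℕ+) : ℕ) - 1) * ∑' k, ‖a k‖ * R ^ k, ?_⟩
    rintro _ ⟨z, hz, rfl⟩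
    exact (Complex.re_le_norm _).trans
      (tsum_of_norm_bounded hu.hasSum fun n => norm_tsum_pow_le h hR0 hR1 n hz)
  rw [hasProdUniformlyOn_iff_tendstoUniformlyOn]
  refine (ht.comp_cexp hb).congr (Filter.Eventually.of_forall fun t z _ => ?_)
  simp only [Function.comp_apply, Complex.exp_sum, h.exp_tsum]

lemma hasProd_Psi (S : Submonoid ℕ+) {f : O1} {a : ℕ → ℂ} (h : LogSeries f a) (z : 𝔻) :
    HasProd (fun n : S => toFun f (z ^ (n : ℕ+)))
      (Complex.exp (∑' n : S, ∑' k, a k * ((z ^ (n : ℕ+) : 𝔻) : ℂ) ^ k)) :=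
  (hasProdUniformlyOn_Psi S h (norm_nonneg (z : ℂ)) z.norm_lt_one).hasProd (x := z) (by simp)

lemma Psi_eq (S : Submonoid ℕ+) {f : O1} {a : ℕ → ℂ} (h : LogSeries f a) (z : 𝔻) :
    Psi S f z = Complex.exp (∑' n : S, ∑' k, a k * ((z ^ (n : ℕ+) : 𝔻) : ℂ) ^ k) :=
  (hasProd_Psi S h z).tprod_eq

lemma hasProdLocallyUniformly_Psi (S : Submonoid ℕ+) (f : O1) :
    HasProdLocallyUniformly (fun (n : S) (z : 𝔻) => toFun f (z ^ (n : ℕ+))) (Psi S f) := by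
  refine hasProdLocallyUniformly_of_of_forall_exists_nhds fun z => ?_
  obtain ⟨R, hzR, hR1⟩ := exists_between z.norm_lt_one
  refine ⟨{w : 𝔻 | ‖(w : ℂ)‖ ≤ R}, ?_, ?_⟩
  · have hc : Continuous fun w : 𝔻 => ‖(w : ℂ)‖ := Complex.UnitDisc.continuous_coe.norm
    exact Filter.mem_of_superset ((isOpen_Iio.preimage hc).mem_nhds hzR) fun w hw => by
      simpa using le_of_lt (by simpa using hw : ‖(w : ℂ)‖ < R)
  · exact (hasProdUniformlyOn_Psi S (logSeries_logCoeff f)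
      ((norm_nonneg _).trans hzR.le) hR1).congr_right
      fun w _ => (Psi_eq S (logSeries_logCoeff f) w).symm

/-- The summand `F` is kept abstract so that the same reindexing serves the series itself and the
series of norms. -/
lemma tsum_logCoeff_pull {M : Type*} [AddCommMonoid M] [TopologicalSpace M] [T2Space M] (f : O1)
    (n : ℕ+) (F : ℂ → ℕ → M) (hF : ∀ k, F 0 k = 0) :
    ∑' k, F (logCoeff (pull n f) k) k = ∑' k, F (logCoeff f k) (n * k) := by
  have hinj : Function.Injective fun k : ℕ => (n : ℕ) * k :=
    fun a b h => Nat.eq_of_mul_eq_mul_left n.pos h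
  rw [← hinj.tsum_eq]
  · simp [logCoeff_pull]
  · intro k hk
    by_contra hk'
    have : ¬ (n : ℕ) ∣ k := fun ⟨m, hm⟩ => hk' ⟨m, hm.symm⟩
    exact hk (by simp [logCoeff_pull, this, hF])

/-- Absolute summability over both indices allows the sum over factors and the sum over powers of
`z` to be exchanged, which turns an infinite product into an element of `O1` with explicit
coefficients. -/
lemma exists_logSeries_of_summable_prod {ι : Type*} {c : ι → ℕ → ℂ} (h0 : ∀ i, c i 0 = 0)
    (hc : ∀ z : 𝔻, Summable fun p : ι × ℕ => c p.1 p.2 * (z : ℂ) ^ p.2) :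
    ∃ g : O1, LogSeries g (fun k => ∑' i, c i k) ∧
      ∀ z, toFun g z = Complex.exp (∑' i, ∑' k, c i k * (z : ℂ) ^ k) := by
  have hterm : ∀ (z : 𝔻) (k : ℕ), ∑' i, c i k * (z : ℂ) ^ k = (∑' i, c i k) * (z : ℂ) ^ k :=
    fun z k => tsum_mul_right
  have hsummable : ∀ z : 𝔻, Summable fun k => (∑' i, c i k) * (z : ℂ) ^ k := by
    intro z
    simp_rw [← hterm z]
    have h := (hc z).prod_symm
    exact Summable.prod (f := fun p : ℕ × ι => c p.2 p.1 * (z : ℂ) ^ p.1) h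
  obtain ⟨g, hg⟩ := exists_of_summable
    (a := fun k => ∑' i, c i k) (by simp [h0]) hsummable
  refine ⟨g, hg, fun z => ?_⟩
  have hcomm : ∑' k, ∑' i, c i k * (z : ℂ) ^ k = ∑' i, ∑' k, c i k * (z : ℂ) ^ k :=
    Summable.tsum_comm (f := fun i k => c i k * (z : ℂ) ^ k) (hc z)
  rw [← hg.exp_tsum, ← hcomm]
  simp_rw [hterm z]

lemma summable_logCoeff_pull (S : Submonoid ℕ+) (f : O1) (z : 𝔻) :
    Summable fun p : S × ℕ => logCoeff (pull p.1 f) p.2 * (z : ℂ) ^ p.2 := by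
  have hz0 := norm_nonneg (z : ℂ)
  refine Summable.of_norm ((summable_prod_of_nonneg fun p => norm_nonneg _).2 ⟨fun n => ?_, ?_⟩)
  · exact ((logSeries_logCoeff (pull n f)).summable z).norm
  · refine (summable_pow_pred S hz0 z.norm_lt_one
      (∑' k, ‖logCoeff f k‖ * ‖(z : ℂ)‖ ^ k)).of_nonneg_of_le
      (fun n => tsum_nonneg fun _ => norm_nonneg _) fun n => ?_
    simp only [norm_mul, norm_pow]
    rw [tsum_logCoeff_pull f n (fun c k => ‖c‖ * ‖(z : ℂ)‖ ^ k) (by simp)]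
    exact tsum_norm_pow_mul_le (logSeries_logCoeff f) hz0 z.norm_lt_one n

lemma exists_logSeries_Psi (S : Submonoid ℕ+) (f : O1) :
    ∃ g : O1, LogSeries g (fun k => ∑' n : S, logCoeff (pull n f) k) ∧
      ∀ z, toFun g z = Psi S f z := by
  obtain ⟨g, hg, hgz⟩ := exists_logSeries_of_summable_prod
    (c := fun (n : S) k => logCoeff (pull n f) k) (fun n => logCoeff_zero _)
    (summable_logCoeff_pull S f)
  refine ⟨g, hg, fun z => ?_⟩
  rw [hgz, Psi_eq S (logSeries_logCoeff f)]
  congr 1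
  refine tsum_congr fun n => ?_
  rw [tsum_logCoeff_pull f n (fun c k => c * (z : ℂ) ^ k) (by simp)]
  simp [pow_mul]

/-! ### `Psi` as the inverse of `Phi` -/

section Inverse

variable {s : ℕ} {N : Fin s → ℕ+}

/-- The sum on the left runs over the `n` dividing `N i * k`. If such an `n` is coprime to `N i`,
then `N i` divides the quotient and the coefficient is zero; the remaining `n = N i * m` reproduce
the sum on the right. -/
lemma tsum_logCoeff_pull_mul (hcop : Pairwise fun i j => (N i).Coprime (N j)) {f : O1}
    (hf : ∀ i k, (N i : ℕ) ∣ k → logCoeff f k = 0) (i : Fin s) (k : ℕ) :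
    ∑' n : mon N, logCoeff (pull n f) (N i * k) = ∑' n : mon N, logCoeff (pull n f) k := by
  have hinj : Function.Injective fun n : mon N => (⟨N i, mem_mon N i⟩ * n : mon N) :=
    fun a b h => mul_left_cancel h
  rw [← hinj.tsum_eq]
  · refine tsum_congr fun n => ?_
    simp only [logCoeff_pull, Submonoid.coe_mul, PNat.mul_coe,
      Nat.mul_dvd_mul_iff_left (N i).pos, Nat.mul_div_mul_left _ _ (N i).pos]
  · rintro ⟨n, hn⟩ hnk
    rcases coprime_or_exists_of_mem_mon hcop i hn with h | ⟨m, hm, rfl⟩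
    · refine absurd ?_ hnk
      simp only [logCoeff_pull, ite_eq_right_iff]
      intro hd
      refine hf i _ ?_
      obtain ⟨j, rfl⟩ := h.symm.dvd_of_dvd_mul_left hd
      rw [mul_left_comm, Nat.mul_div_cancel_left _ n.pos]
      exact Dvd.intro _ rfl
    · exact ⟨⟨m, hm⟩, rfl⟩

lemma exists_Phi_eq (hN : ∀ i, 2 ≤ N i) (hcop : Pairwise fun i j => (N i).Coprime (N j)) {f : O1}
    (hf : f ∈ Z (mon N) ⊤) :
    ∃ g ∈ H0 (mon N) ⊤, Phi N g = f ∧ ∀ z, toFun g z = Psi (mon N) f z := by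
  have hfZ := ((mem_Z_iff hN).1 hf).2
  obtain ⟨g, hg, hgz⟩ := exists_logSeries_Psi (mon N) f
  have hinv : ∀ i k, logCoeff g (N i * k) = logCoeff g k := by
    intro i k
    rw [hg.logCoeff_eq]
    exact tsum_logCoeff_pull_mul hcop hfZ i k
  refine ⟨g, mem_H0_iff.2 ⟨Subgroup.mem_top _, hinv⟩, ?_, hgz⟩
  rw [Phi_eq_Omega hcop hinv]
  refine logCoeff_injective (funext fun k => ?_)
  rw [logCoeff_Omega, hg.logCoeff_eq]
  simp only
  split_ifs with hk
  · obtain ⟨i, hi⟩ := hk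
    exact (hfZ i k hi).symm
  -- When no `N i` divides `k`, the only element of the monoid dividing `k` is `1`.
  · rw [tsum_eq_single (1 : mon N)]
    · simp [logCoeff_pull]
    · rintro ⟨n, hn⟩ h1
      simp only [logCoeff_pull, ite_eq_right_iff]
      intro hd
      obtain ⟨i, m, -, rfl⟩ := exists_dvd_of_mem_mon hn fun h => h1 (Subtype.ext h)
      rw [PNat.mul_coe] at hd
      exact absurd ⟨i, (Dvd.intro _ rfl).trans hd⟩ hk

/-- The isomorphism `Φ` from `H⁰(S, O¹)` to `Z(S, O¹)`. -/
lemma exists_Phi_equiv (hN : ∀ i, 2 ≤ N i) (hcop : Pairwise fun i j => (N i).Coprime (N j)) :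
    ∃ E : H0 (mon N) ⊤ ≃* Z (mon N) ⊤, (∀ f, (E f : O1) = Phi N f) ∧
      ∀ (α : Z (mon N) ⊤) (z : 𝔻), toFun (E.symm α : O1) z = Psi (mon N) α z := by
  have hmem : ∀ f : H0 (mon N) ⊤, Phi N f ∈ Z (mon N) ⊤ := fun f => by
    rw [Phi_eq_Omega hcop (mem_H0_iff.1 f.2).2]
    exact Omega_mem_Z hN
  let φ : H0 (mon N) ⊤ →* Z (mon N) ⊤ := ((Phi N).comp (Subgroup.subtype _)).codRestrict _ hmem
  have hφ : Function.Bijective φ := by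
    refine ⟨fun f g h => Subtype.ext (Phi_injOn hN hcop (mem_H0_iff.1 f.2).2
      (mem_H0_iff.1 g.2).2 (congrArg Subtype.val h)), fun α => ?_⟩
    obtain ⟨g, hg, hgα, -⟩ := exists_Phi_eq hN hcop α.2
    exact ⟨⟨g, hg⟩, Subtype.ext hgα⟩
  refine ⟨MulEquiv.ofBijective φ hφ, fun f => rfl, fun α z => ?_⟩
  obtain ⟨g, hg, hgα, hgz⟩ := exists_Phi_eq hN hcop α.2
  have : (MulEquiv.ofBijective φ hφ).symm α = ⟨g, hg⟩ := by
    rw [MulEquiv.symm_apply_eq]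
    exact Subtype.ext hgα.symm
  rw [this, hgz]

end Inverse

/-! ### Quotients by the images of the pullbacks -/

/-- Subgroups of `O1` stable under pullback, the projections `e_n`, and descent along
`z ↦ z ^ n`. -/
structure IsAdmissible (G : Subgroup O1) : Prop where
  pull_mem : ∀ n, ∀ f ∈ G, pull n f ∈ G
  idem_mem : ∀ n, ∀ f ∈ G, idem n f ∈ G
  of_pull_mem : ∀ n f, pull n f ∈ G → f ∈ G

lemma isAdmissible_top : IsAdmissible ⊤ :=
  ⟨fun _ _ _ => Subgroup.mem_top _, fun _ _ _ => Subgroup.mem_top _,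
    fun _ _ _ => Subgroup.mem_top _⟩

section Quotient

variable {s : ℕ} {N : Fin s → ℕ+} {G : Subgroup O1}

/-- The two descriptions of `Phi` are used for different purposes: as a composite of pullbacks it
preserves `G`, and as `Omega` it lands in the kernel of the traces. -/
lemma exists_Phi_hom (hN : ∀ i, 2 ≤ N i) (hcop : Pairwise fun i j => (N i).Coprime (N j))
    (hG : IsAdmissible G) : ∃ φ : H0 (mon N) G →* Z (mon N) G,
      (∀ f, (φ f : O1) = Phi N f) ∧ Function.Injective φ := by
  have hmem : ∀ f : H0 (mon N) G, Phi N f ∈ Z (mon N) G := fun f => by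
    have hf := mem_H0_iff.1 f.2
    refine (mem_Z_iff hN).2 ⟨?_, ?_⟩
    · rw [Phi_eq_listOp]
      exact listOp_mem hG.pull_mem _ hf.1
    · rw [Phi_eq_Omega hcop hf.2]
      exact ((mem_Z_iff hN).1 (Omega_mem_Z hN)).2
  refine ⟨((Phi N).comp (Subgroup.subtype _)).codRestrict _ hmem, fun f => rfl, fun f g h => ?_⟩
  exact Subtype.ext (Phi_injOn hN hcop (mem_H0_iff.1 f.2).2 (mem_H0_iff.1 g.2).2
    (congrArg Subtype.val h))

lemma Omega_mem_Z_of_mem (hN : ∀ i, 2 ≤ N i) (hG : IsAdmissible G) {f : O1} (hf : f ∈ G) :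
    Omega N f ∈ Z (mon N) G := by
  refine (mem_Z_iff hN).2 ⟨?_, ((mem_Z_iff hN).1 (Omega_mem_Z hN)).2⟩
  rw [Omega_eq_listOp]
  exact listOp_mem hG.idem_mem _ hf

lemma Omega_eq_one_of_mem_powS {u : G} (hu : u ∈ powS (mon N) G) : Omega N u = 1 := by
  have h : powS (mon N) G ≤ ((Omega N).comp G.subtype).ker := by
    rw [powS, Subgroup.closure_le]
    rintro g ⟨n, hn, h1, m, hm⟩
    change Omega N (g : O1) = 1
    rw [hm]
    exact Omega_pull hn h1 _
  exact h hu

/-- Each factor `1 - e_n` divides by `idem n v` with `v ∈ G`. This is `pull n m` for some `m`, which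
lies in `G` by descent, so the class modulo `powS S G` never changes. -/
lemma div_listOp_idem_mem (hG : IsAdmissible G) {S : Submonoid ℕ+} {l : List ℕ+}
    (hl : ∀ n ∈ l, n ∈ S ∧ n ≠ 1) {u : O1} (hu : u ∈ G) :
    u / listOp idem l u ∈ (powS S G).map G.subtype := by
  induction l with
  | nil => rw [listOp_nil, div_self']; exact one_mem _
  | cons n l ih =>
    have ih' := ih fun m hm => hl m (List.mem_cons_of_mem _ hm)
    have hv := listOp_mem hG.idem_mem l hu
    rw [listOp_cons, ← div_mul]
    refine mul_mem ih' ?_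
    obtain ⟨m, hm⟩ := exists_pull_eq_idem n (listOp idem l u)
    have hi := hG.idem_mem n _ hv
    obtain ⟨hnS, hn1⟩ := hl n List.mem_cons_self
    exact ⟨⟨_, hi⟩, Subgroup.subset_closure
      ⟨n, hnS, hn1, ⟨m, hG.of_pull_mem n m (hm ▸ hi)⟩, hm.symm⟩, rfl⟩

lemma proj_injective (hN : ∀ i, 2 ≤ N i) : Function.Injective (proj (mon N) G) := by
  rw [injective_iff_map_eq_one]
  intro m hm
  have h1 : Subgroup.inclusion (Z_le (mon N) G) m ∈ powS (mon N) G :=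
    (QuotientGroup.eq_one_iff _).1 hm
  have h2 := Omega_eq_one_of_mem_powS h1
  have h3 : Omega N (m : O1) = m := Omega_eq_self hN m.2
  exact Subtype.ext (h3.symm.trans h2)

lemma proj_Omega (hN : ∀ i, 2 ≤ N i) (hG : IsAdmissible G) (u : G) :
    proj (mon N) G ⟨Omega N u, Omega_mem_Z_of_mem hN hG u.2⟩ = QuotientGroup.mk u := by
  have hl : ∀ n ∈ List.ofFn N, n ∈ mon N ∧ n ≠ 1 := by
    intro n hn
    obtain ⟨i, rfl⟩ := (List.mem_ofFn' N n).1 hn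
    refine ⟨mem_mon N i, fun h => ?_⟩
    have := hN i
    rw [h] at this
    exact absurd this (by decide)
  obtain ⟨v, hv, hvu⟩ := div_listOp_idem_mem hG hl u.2
  refine QuotientGroup.eq.2 ?_
  have hv' : (⟨Omega N u, (Omega_mem_Z_of_mem hN hG u.2).1⟩ : G)⁻¹ * u = v := by
    refine Subtype.ext ?_
    change (Omega N (u : O1))⁻¹ * (u : O1) = v
    rw [Omega_eq_listOp, mul_comm, ← div_eq_mul_inv]
    exact hvu.symm
  exact hv' ▸ hv

lemma exists_proj_equiv (hN : ∀ i, 2 ≤ N i) (hG : IsAdmissible G) :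
    ∃ P : Z (mon N) G ≃* G ⧸ powS (mon N) G, (∀ m, P m = proj (mon N) G m) ∧
      ∀ u : G, (P.symm (QuotientGroup.mk u) : O1) = Omega N u := by
  have hbij : Function.Bijective (proj (mon N) G) := by
    refine ⟨proj_injective hN, fun x => ?_⟩
    obtain ⟨u, rfl⟩ := QuotientGroup.mk_surjective x
    exact ⟨_, proj_Omega hN hG u⟩
  refine ⟨MulEquiv.ofBijective _ hbij, fun m => rfl, fun u => ?_⟩
  have : (MulEquiv.ofBijective _ hbij).symm (QuotientGroup.mk u) =
      ⟨Omega N u, Omega_mem_Z_of_mem hN hG u.2⟩ := by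
    rw [MulEquiv.symm_apply_eq]
    exact (proj_Omega hN hG u).symm
  rw [this]

lemma quotMap_proj {S : Submonoid ℕ+} {H : Subgroup O1} (h : G ≤ H) (m : Z S G) (m' : Z S H)
    (hm : (m : O1) = m') : quotMap S h (proj S G m) = proj S H m' := by
  change QuotientGroup.mk _ = QuotientGroup.mk _
  congr 1
  exact Subtype.ext hm

/-- Each class of `G` has a representative in `Z`, which also lies in `Z` for `H`; there the
projection to the quotient is injective, whether or not `H` is admissible. -/
lemma quotMap_injective (hN : ∀ i, 2 ≤ N i) (hG : IsAdmissible G) {H : Subgroup O1} (h : G ≤ H) :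
    Function.Injective (quotMap (mon N) h) := by
  rw [injective_iff_map_eq_one]
  intro x hx
  obtain ⟨u, rfl⟩ := QuotientGroup.mk_surjective x
  rw [← proj_Omega hN hG u] at hx ⊢
  set m : Z (mon N) G := ⟨Omega N u, Omega_mem_Z_of_mem hN hG u.2⟩
  have hm : (m : O1) ∈ Z (mon N) H := ⟨h m.2.1, m.2.2⟩
  rw [quotMap_proj h m ⟨m, hm⟩ rfl] at hx
  have h1 := (injective_iff_map_eq_one _).1 (proj_injective hN) _ hx
  have h2 : m = 1 := Subtype.ext (congrArg (fun y : Z (mon N) H => (y : O1)) h1)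
  rw [h2, map_one]

end Quotient

/-! ### The circle as the quotient of `ℝ` by `2πℤ` -/

instance twoPi_pos_fact : Fact (0 < 2 * Real.pi) := ⟨Real.two_pi_pos⟩

/-- The circle `ℝ / 2πℤ`. -/
abbrev Torus : Type := AddCircle (2 * Real.pi)

/-- The inclusion `θ ↦ exp (i θ)` of the circle in `ℂ`. -/
noncomputable def torusExp (x : Torus) : ℂ := (AddCircle.toCircle x : ℂ)

lemma torusExp_coe (θ : ℝ) : torusExp (θ : Torus) = Complex.exp (θ * Complex.I) := by
  rw [torusExp, AddCircle.toCircle_apply_mk, div_self Real.two_pi_pos.ne', one_mul, Circle.coe_exp]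

lemma continuous_torusExp : Continuous torusExp :=
  continuous_subtype_val.comp AddCircle.continuous_toCircle

lemma norm_torusExp (x : Torus) : ‖torusExp x‖ = 1 := Circle.norm_coe _

lemma torusExp_nsmul (n : ℕ) (x : Torus) : torusExp (n • x) = torusExp x ^ n := by
  rw [torusExp, AddCircle.toCircle_nsmul, Circle.coe_pow, torusExp]

lemma torusExp_add (x y : Torus) : torusExp (x + y) = torusExp x * torusExp y := by
  rw [torusExp, AddCircle.toCircle_add, Circle.coe_mul, torusExp, torusExp]

lemma norm_ofReal_mul_torusExp {r : ℝ} (hr : 0 ≤ r) (x : Torus) : ‖(r : ℂ) * torusExp x‖ = r := by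
  rw [norm_mul, norm_torusExp, mul_one, Complex.norm_of_nonneg hr]

lemma circleAverage_eq_integral_torus {E : Type*} [NormedAddCommGroup E] [NormedSpace ℝ E]
    (F : ℂ → E) (r : ℝ) :
    Real.circleAverage F 0 r = (2 * Real.pi)⁻¹ • ∫ t : Torus, F (r * torusExp t) := by
  rw [Real.circleAverage_def, ← AddCircle.intervalIntegral_preimage (2 * Real.pi) 0, zero_add]
  simp_rw [torusExp_coe, circleMap, zero_add]

lemma cos_norm_coe (θ : ℝ) : Real.cos ‖(θ : Torus)‖ = Real.cos θ := by
  rw [AddCircle.norm_eq, Real.cos_abs, Real.cos_sub_int_mul_two_pi]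

lemma norm_le_pi (x : Torus) : ‖x‖ ≤ Real.pi := by
  have := AddCircle.norm_le_half_period (2 * Real.pi) (x := x) Real.two_pi_pos.ne'
  rwa [abs_of_pos Real.two_pi_pos, mul_div_cancel_left₀ _ two_ne_zero] at this

/-- The law of cosines, with the angle written as a distance on the circle. The Poisson kernel
thereby becomes a decreasing function of `dist t x`, which is why its superlevel sets are balls. -/
lemma normSq_torusExp_sub (r : ℝ) (x t : Torus) :
    ‖torusExp t - r * torusExp x‖ ^ 2 = 1 + r ^ 2 - 2 * r * Real.cos (dist t x) := by
  induction x using QuotientAddGroup.induction_on with | _ a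
  induction t using QuotientAddGroup.induction_on with | _ b
  change ‖torusExp (b : Torus) - r * torusExp (a : Torus)‖ ^ 2 =
    1 + r ^ 2 - 2 * r * Real.cos (dist (b : Torus) (a : Torus))
  rw [dist_eq_norm, ← AddCircle.coe_sub, cos_norm_coe, torusExp_coe, torusExp_coe, ← Complex.normSq_eq_norm_sq,
    Complex.normSq_apply, Real.cos_sub]
  simp only [Complex.sub_re, Complex.sub_im, Complex.mul_re, Complex.mul_im, Complex.ofReal_re,
    Complex.ofReal_im, Complex.exp_ofReal_mul_I_re, Complex.exp_ofReal_mul_I_im]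
  have ha := Real.sin_sq_add_cos_sq a
  have hb := Real.sin_sq_add_cos_sq b
  linear_combination hb + r ^ 2 * ha

lemma poissonKernel_torusExp {r : ℝ} (x t : Torus) :
    poissonKernel 0 (r * torusExp x) (torusExp t) =
      (1 - r ^ 2) / (1 + r ^ 2 - 2 * r * Real.cos (dist t x)) := by
  rw [poissonKernel, sub_zero, sub_zero, normSq_torusExp_sub, norm_torusExp, norm_mul,
    norm_torusExp, mul_one, one_pow, Complex.norm_real, Real.norm_eq_abs, sq_abs]

/-- The expression equals `(1 - r) ^ 2 + 2 * r * (1 - cos d)`. -/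
lemma poisson_denom_pos {r : ℝ} (hr0 : 0 ≤ r) (hr1 : r < 1) (d : ℝ) :
    0 < 1 + r ^ 2 - 2 * r * Real.cos d := by
  nlinarith [Real.cos_le_one d, mul_nonneg hr0 (sub_nonneg.2 (Real.cos_le_one d)),
    pow_pos (sub_pos.2 hr1) 2]

lemma poissonKernel_nonneg {w : ℂ} (hw : ‖w‖ < 1) (t : Torus) :
    0 ≤ poissonKernel 0 w (torusExp t) := by
  rw [poissonKernel, sub_zero, sub_zero, norm_torusExp]
  have := pow_le_one₀ (n := 2) (norm_nonneg w) hw.le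
  exact div_nonneg (by linarith) (by positivity)

lemma torusExp_ne {w : ℂ} (hw : ‖w‖ < 1) (t : Torus) : torusExp t - w ≠ 0 := by
  intro h
  rw [sub_eq_zero] at h
  rw [← h, norm_torusExp] at hw
  exact lt_irrefl _ hw

lemma continuous_poissonKernel {w : ℂ} (hw : ‖w‖ < 1) :
    Continuous fun t => poissonKernel 0 w (torusExp t) := by
  simp only [poissonKernel, sub_zero]
  have h := continuous_torusExp
  refine Continuous.div (by fun_prop) (by fun_prop) fun t => ?_
  exact pow_ne_zero _ (norm_ne_zero_iff.2 (torusExp_ne hw t))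

lemma integrable_of_continuous {E : Type*} [NormedAddCommGroup E] {f : Torus → E}
    (hf : Continuous f) (ν : Measure Torus) [IsFiniteMeasure ν] : Integrable f ν :=
  hf.integrable_of_hasCompactSupport (HasCompactSupport.of_compactSpace f)

lemma integral_poissonKernel {w : ℂ} (hw : ‖w‖ < 1) :
    ∫ t : Torus, poissonKernel 0 w (torusExp t) = 2 * Real.pi := by
  have h := DiffContOnCl.circleAverage_poissonKernel_smul (f := fun _ => (1 : ℂ)) (R := 1) (c := 0)
    (w := w) diffContOnCl_const (by simpa using hw)
  rw [circleAverage_eq_integral_torus] at h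
  simp only [Complex.ofReal_one, one_mul, Pi.smul_apply', Complex.real_smul, mul_one,
    integral_complex_ofReal] at h
  have h2 : (2 * Real.pi)⁻¹ * ∫ t : Torus, poissonKernel 0 w (torusExp t) = 1 := by
    exact_mod_cast h
  have := Real.two_pi_pos.ne'
  field_simp at h2
  linarith

/-! ### Fatou's theorem for Poisson integrals of measures -/

/-- Comparison of the integrals of a kernel with respect to two measures, in terms of the measures
of its superlevel sets. -/
lemma integral_le_of_superlevel {X : Type*} [MeasurableSpace X] {μ ν : Measure X}
    [IsFiniteMeasure μ] [IsFiniteMeasure ν] {K : X → ℝ} (hK0 : ∀ x, 0 ≤ K x) (hμ : Integrable K μ)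
    (hν : Integrable K ν) {b κ s₀ : ℝ} (hb : 0 ≤ b) {a : ℝ} (ha : 0 ≤ a) (hκ : 0 ≤ κ)
    (h : ∀ s, κ < s → s ≠ s₀ →
      ENNReal.ofReal b * μ {x | s ≤ K x} ≤ ENNReal.ofReal a * ν {x | s ≤ K x}) :
    b * ∫ x, K x ∂μ ≤ a * ∫ x, K x ∂ν + κ * b * μ.real Set.univ := by
  have key : ENNReal.ofReal b * ∫⁻ x, ENNReal.ofReal (K x) ∂μ ≤
      ENNReal.ofReal a * ∫⁻ x, ENNReal.ofReal (K x) ∂ν +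
        ENNReal.ofReal κ * (ENNReal.ofReal b * μ Set.univ) := by
    -- Layer cake formula, with the `μ`-integral cut at height `κ`: above `κ` the hypothesis applies
    -- for almost every level, and below `κ` each superlevel set has measure at most `μ univ`.
    rw [lintegral_eq_lintegral_meas_le μ (ae_of_all _ hK0) hμ.aemeasurable,
      lintegral_eq_lintegral_meas_le ν (ae_of_all _ hK0) hν.aemeasurable,
      ← lintegral_const_mul' _ _ ENNReal.ofReal_ne_top,
      ← lintegral_const_mul' _ _ ENNReal.ofReal_ne_top,
      ← Set.Ioc_union_Ioi_eq_Ioi hκ, lintegral_union measurableSet_Ioi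
        (Set.disjoint_left.2 fun x hx hx' => not_lt.2 hx.2 hx'), add_comm]
    refine add_le_add ?_ ?_
    · refine le_trans (lintegral_mono_ae ?_) (lintegral_mono_set Set.subset_union_right)
      filter_upwards [ae_restrict_mem measurableSet_Ioi,
        ae_restrict_of_ae (Measure.ae_ne volume s₀)] with s hs hs0 using h s hs hs0
    · refine le_trans (lintegral_mono (g := fun _ => ENNReal.ofReal b * μ Set.univ)
        fun s => mul_le_mul_right (measure_mono (Set.subset_univ _)) _) ?_
      rw [setLIntegral_const, Real.volume_Ioc, sub_zero, mul_comm]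
  have hI : ∀ {ρ : Measure X}, 0 ≤ ∫ x, K x ∂ρ := fun {ρ} => integral_nonneg hK0
  rw [← ofReal_integral_eq_lintegral_ofReal hμ (ae_of_all _ hK0),
    ← ofReal_integral_eq_lintegral_ofReal hν (ae_of_all _ hK0),
    ← ofReal_measureReal, ← ENNReal.ofReal_mul hb, ← ENNReal.ofReal_mul hb,
    ← ENNReal.ofReal_mul ha, ← ENNReal.ofReal_mul hκ,
    ← ENNReal.ofReal_add (mul_nonneg ha hI) (by positivity),
    ENNReal.ofReal_le_ofReal_iff (add_nonneg (mul_nonneg ha hI) (by positivity))] at key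
  linarith

/-- The superlevel sets of the Poisson kernel are empty or balls around its pole. -/
lemma poisson_superlevel {r : ℝ} (hr0 : 0 < r) (hr1 : r < 1) (x : Torus) {δ : ℝ} (hδ0 : 0 ≤ δ)
    (hδ : δ ≤ Real.pi) {s : ℝ} (hs : (1 - r ^ 2) / (1 + r ^ 2 - 2 * r * Real.cos δ) < s)
    (hs0 : s ≠ (1 - r ^ 2) / (1 - r) ^ 2) :
    {t | s ≤ poissonKernel 0 (r * torusExp x) (torusExp t)} = ∅ ∨
    ∃ ρ, 0 < ρ ∧ ρ ≤ δ ∧ {t | s ≤ poissonKernel 0 (r * torusExp x) (torusExp t)} =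
      Metric.closedBall x ρ := by
  have h1r : 0 < 1 - r ^ 2 := by nlinarith
  have hspos : 0 < s := lt_of_le_of_lt (div_pos h1r (poisson_denom_pos hr0.le hr1 δ)).le hs
  -- The value of `cos d` at which the kernel equals `s`.
  set c := (1 + r ^ 2 - (1 - r ^ 2) / s) / (2 * r) with hc
  have hlevel : ∀ d, s ≤ (1 - r ^ 2) / (1 + r ^ 2 - 2 * r * Real.cos d) ↔ c ≤ Real.cos d := by
    intro d
    have hpos := poisson_denom_pos hr0.le hr1 d
    rw [le_div_iff₀ hpos, hc, div_le_iff₀ (by positivity), sub_le_comm, le_div_iff₀ hspos]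
    constructor <;> intro h <;> nlinarith
  have hset : {t | s ≤ poissonKernel 0 (r * torusExp x) (torusExp t)} =
      {t | c ≤ Real.cos (dist t x)} := by
    ext t
    simp only [Set.mem_ofPred_eq]
    rw [poissonKernel_torusExp, hlevel]
  rw [hset]
  have hcδ : Real.cos δ ≤ c := by
    have := (hlevel δ).not.1 (not_le.2 hs)
    exact (not_le.1 this).le
  rcases lt_trichotomy c 1 with h1 | h1 | h1
  · right
    refine ⟨Real.arccos c, Real.arccos_pos.2 h1, ?_, ?_⟩
    · rw [← Real.arccos_cos hδ0 hδ]
      exact Real.arccos_le_arccos hcδ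
    · ext t
      simp only [Set.mem_ofPred_eq, Metric.mem_closedBall]
      have hd0 : 0 ≤ dist t x := dist_nonneg
      have hdπ : dist t x ≤ Real.pi := by rw [dist_eq_norm]; exact norm_le_pi _
      constructor
      · intro h
        rw [← Real.arccos_cos hd0 hdπ]
        exact Real.arccos_le_arccos h
      · intro h
        have hm : -1 ≤ c := (Real.neg_one_le_cos δ).trans hcδ
        rw [← Real.cos_arccos hm h1.le]
        exact Real.cos_le_cos_of_nonneg_of_le_pi hd0 (Real.arccos_le_pi c) h
  -- Here `s` is the maximum of the kernel and the superlevel set is the single point `x`; this one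
  -- level is excluded by hypothesis.
  · refine absurd ?_ hs0
    rw [hc, div_eq_iff (by positivity)] at h1
    have h2 : (1 - r ^ 2) / s = (1 - r) ^ 2 := by linarith
    have h3 : (1 - r) ^ 2 ≠ 0 := by
      have : 0 < 1 - r := by linarith
      positivity
    rw [div_eq_iff hspos.ne'] at h2
    rw [eq_div_iff h3, h2, mul_comm]
  · left
    ext t
    simp only [Set.mem_ofPred_eq, Set.mem_empty_iff_false, iff_false, not_le]
    exact lt_of_le_of_lt (Real.cos_le_one _) h1

lemma tendsto_poisson_away {δ : ℝ} (hδ0 : 0 < δ) (hδ : δ ≤ Real.pi) :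
    Tendsto (fun r : ℝ => (1 - r ^ 2) / (1 + r ^ 2 - 2 * r * Real.cos δ)) (𝓝[<] 1) (𝓝 0) := by
  have hcos : Real.cos δ < 1 := by
    rw [← Real.cos_zero]
    exact Real.cos_lt_cos_of_nonneg_of_le_pi le_rfl hδ hδ0
  have h : ContinuousAt (fun r : ℝ => (1 - r ^ 2) / (1 + r ^ 2 - 2 * r * Real.cos δ)) 1 := by
    refine ContinuousAt.div (by fun_prop) (by fun_prop) ?_
    intro h0
    linarith
  have h2 := h.tendsto.mono_left (nhdsWithin_le_nhds (s := Set.Iio 1))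
  simpa using h2

/-- The last term is an error that tends to `0` as `r → 1`. The measures play symmetric roles, so
taking one of them to be `volume` yields both the lower and the upper bound in Fatou's theorem. -/
lemma poisson_le_of_ball {μ ν : Measure Torus} [IsFiniteMeasure μ] [IsFiniteMeasure ν] {r : ℝ}
    (hr0 : 0 < r) (hr1 : r < 1) (x : Torus) {δ : ℝ} (hδ0 : 0 ≤ δ) (hδ : δ ≤ Real.pi) {a b : ℝ}
    (ha : 0 ≤ a) (hb : 0 ≤ b) (h : ∀ ρ, 0 < ρ → ρ ≤ δ → ENNReal.ofReal b *
      μ (Metric.closedBall x ρ) ≤ ENNReal.ofReal a * ν (Metric.closedBall x ρ)) :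
    b * ∫ t, poissonKernel 0 (r * torusExp x) (torusExp t) ∂μ ≤
      a * ∫ t, poissonKernel 0 (r * torusExp x) (torusExp t) ∂ν +
        (1 - r ^ 2) / (1 + r ^ 2 - 2 * r * Real.cos δ) * b * μ.real Set.univ := by
  have hw : ‖(r : ℂ) * torusExp x‖ < 1 := by rwa [norm_ofReal_mul_torusExp hr0.le]
  have hc := continuous_poissonKernel hw
  refine integral_le_of_superlevel (s₀ := (1 - r ^ 2) / (1 - r) ^ 2) (poissonKernel_nonneg hw)
    (integrable_of_continuous hc μ) (integrable_of_continuous hc ν) hb ha ?_ ?_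
  · exact div_nonneg (by nlinarith) (poisson_denom_pos hr0.le hr1 δ).le
  · intro s hs hs0
    rcases poisson_superlevel hr0 hr1 x hδ0 hδ hs hs0 with h0 | ⟨ρ, hρ0, hρ, hs⟩
    · rw [h0]; simp
    · rw [hs]; exact h ρ hρ0 hρ

lemma volume_closedBall_pos (x : Torus) {ρ : ℝ} (hρ : 0 < ρ) :
    0 < (volume : Measure Torus) (Metric.closedBall x ρ) := by
  rw [AddCircle.volume_closedBall, ENNReal.ofReal_pos]
  exact lt_min Real.two_pi_pos (by linarith)

lemma tendsto_poisson_of_tendsto_ratio {ν : Measure Torus} [IsFiniteMeasure ν] {x : Torus} {d : ℝ}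
    (hd0 : 0 ≤ d) (hd : Tendsto (fun ρ => ν (Metric.closedBall x ρ) /
      (volume : Measure Torus) (Metric.closedBall x ρ)) (𝓝[>] 0) (𝓝 (ENNReal.ofReal d))) :
    Tendsto (fun r : ℝ => ∫ t, poissonKernel 0 (r * torusExp x) (torusExp t) ∂ν) (𝓝[<] 1)
      (𝓝 (2 * Real.pi * d)) := by
  have hpi := Real.pi_pos
  have hvol : (volume : Measure Torus).real Set.univ = 2 * Real.pi := by
    rw [measureReal_def, AddCircle.measure_univ, ENNReal.toReal_ofReal Real.two_pi_pos.le]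
  have hr : ∀ᶠ r : ℝ in 𝓝[<] 1, 0 < r ∧ r < 1 := Ioo_mem_nhdsLT one_pos
  refine tendsto_order.2 ⟨fun l hl => ?_, fun u hu => ?_⟩
  · obtain ⟨d', hd'l, hd'⟩ : ∃ d', l / (2 * Real.pi) < d' ∧ d' < d :=
      exists_between (by rw [div_lt_iff₀ Real.two_pi_pos]; linarith)
    -- `ENNReal.ofReal` would truncate a negative `d'`; in that case `l < 0`, and positivity of the
    -- Poisson integral is enough.
    by_cases hd'0 : d' < 0
    · have hl0 : l < 0 := by
        by_contra! h
        have : 0 ≤ l / (2 * Real.pi) := by positivity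
        linarith
      filter_upwards [hr] with r hr
      refine lt_of_lt_of_le hl0 (integral_nonneg (poissonKernel_nonneg ?_))
      rw [norm_ofReal_mul_torusExp hr.1.le]
      exact hr.2
    push Not at hd'0
    have hlt : ENNReal.ofReal d' < ENNReal.ofReal d :=
      (ENNReal.ofReal_lt_ofReal_iff_of_nonneg hd'0).2 hd'
    have hev := hd.eventually_const_lt hlt
    obtain ⟨δ, hδ0, hδ⟩ := (mem_nhdsGT_iff_exists_Ioc_subset).1 hev
    have hδ0 : 0 < min δ Real.pi := lt_min hδ0 hpi
    have hlim := (((tendsto_poisson_away hδ0 (min_le_right _ _)).mul_const d').mul_const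
      (2 * Real.pi)).const_sub (d' * (2 * Real.pi))
    simp only [zero_mul, sub_zero] at hlim
    have hl' : l < d' * (2 * Real.pi) := by rwa [div_lt_iff₀ Real.two_pi_pos] at hd'l
    filter_upwards [hr, hlim.eventually_const_lt hl'] with r hr hlr
    have := poisson_le_of_ball (μ := volume) (ν := ν) hr.1 hr.2 x hδ0.le (min_le_right _ _)
      zero_le_one hd'0 fun ρ hρ0 hρ => by
        have hm : ρ ∈ Set.Ioc 0 δ := ⟨hρ0, hρ.trans (min_le_left _ _)⟩
        have := hδ hm
        simp only [Set.mem_ofPred_eq] at this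
        rw [ENNReal.lt_div_iff_mul_lt (Or.inl (volume_closedBall_pos x hρ0).ne')
          (Or.inl (measure_ne_top _ _))] at this
        simpa using this.le
    rw [integral_poissonKernel (by rw [norm_ofReal_mul_torusExp hr.1.le]; exact hr.2), hvol] at this
    linarith
  · obtain ⟨d', hd', hd'u⟩ : ∃ d', d < d' ∧ d' < u / (2 * Real.pi) :=
      exists_between (by rw [lt_div_iff₀ Real.two_pi_pos]; linarith)
    have hd'0 : 0 < d' := lt_of_le_of_lt hd0 hd'
    have hlt : ENNReal.ofReal d < ENNReal.ofReal d' := (ENNReal.ofReal_lt_ofReal_iff hd'0).2 hd'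
    have hev := hd.eventually_lt_const hlt
    obtain ⟨δ, hδ0, hδ⟩ := (mem_nhdsGT_iff_exists_Ioc_subset).1 hev
    have hδ0 : 0 < min δ Real.pi := lt_min hδ0 hpi
    have hlim := ((tendsto_poisson_away hδ0 (min_le_right _ _)).mul_const
      (ν.real Set.univ)).const_add (d' * (2 * Real.pi))
    simp only [zero_mul, add_zero] at hlim
    have hu' : d' * (2 * Real.pi) < u := by rwa [lt_div_iff₀ Real.two_pi_pos] at hd'u
    filter_upwards [hr, hlim.eventually_lt_const hu'] with r hr hlr
    have := poisson_le_of_ball (μ := ν) (ν := volume) hr.1 hr.2 x hδ0.le (min_le_right _ _)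
      hd'0.le zero_le_one fun ρ hρ0 hρ => by
        have hm : ρ ∈ Set.Ioc 0 δ := ⟨hρ0, hρ.trans (min_le_left _ _)⟩
        have := hδ hm
        simp only [Set.mem_ofPred_eq] at this
        rw [ENNReal.div_lt_iff (Or.inl (volume_closedBall_pos x hρ0).ne')
          (Or.inl (measure_ne_top _ _))] at this
        simpa using this.le
    rw [integral_poissonKernel (by rw [norm_ofReal_mul_torusExp hr.1.le]; exact hr.2)] at this
    linarith

/-- **Fatou's theorem**: the radial limits of the Poisson integral of a finite measure are given by
its density almost everywhere. -/
theorem ae_tendsto_poisson (ν : Measure Torus) [IsFiniteMeasure ν] :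
    ∀ᵐ x ∂(volume : Measure Torus),
      Tendsto (fun r : ℝ => ∫ t, poissonKernel 0 (r * torusExp x) (torusExp t) ∂ν) (𝓝[<] 1)
        (𝓝 (2 * Real.pi * (ν.rnDeriv volume x).toReal)) := by
  filter_upwards [(IsUnifLocDoublingMeasure.vitaliFamily (volume : Measure Torus)
    1).ae_tendsto_rnDeriv ν, Measure.rnDeriv_lt_top ν volume] with x hx hlt
  refine tendsto_poisson_of_tendsto_ratio ENNReal.toReal_nonneg ?_
  rw [ENNReal.ofReal_toReal hlt.ne]
  refine hx.comp (IsUnifLocDoublingMeasure.tendsto_closedBall_filterAt _ (fun _ => x) id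
    tendsto_id ?_)
  filter_upwards [self_mem_nhdsWithin] with ρ hρ
  exact Metric.mem_closedBall_self (by simpa using le_of_lt hρ)

/-! ### Herglotz representation -/

/-- Measures of bounded mass on a compact space form a weakly compact set. Taking limits along an
ultrafilter avoids extracting subsequences and allows several limits to be taken simultaneously. -/
lemma exists_tendsto_integral_of_bounded {g : ℕ → Torus → ℝ} (hg : ∀ n, Continuous (g n))
    (hg0 : ∀ n t, 0 ≤ g n t) {C : ℝ} (hC : ∀ n, ∫ t, g n t ≤ C) :
    ∃ ν : Measure Torus, IsFiniteMeasure ν ∧ ∀ f : Torus → ℝ, Continuous f →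
      Tendsto (fun n => ∫ t, f t * g n t) (hyperfilter ℕ) (𝓝 (∫ t, f t ∂ν)) := by
  have hint : ∀ n, Integrable (g n) := fun n => integrable_of_continuous (hg n) volume
  have hmass : ∀ n, (volume.withDensity fun t => ENNReal.ofReal (g n t)) Set.univ =
      ENNReal.ofReal (∫ t, g n t) := fun n => by
    rw [withDensity_apply _ MeasurableSet.univ, Measure.restrict_univ,
      ofReal_integral_eq_lintegral_ofReal (hint n) (ae_of_all _ (hg0 n))]
  let μ : ℕ → FiniteMeasure Torus := fun n =>
    ⟨volume.withDensity fun t => ENNReal.ofReal (g n t), ⟨by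
      rw [hmass]; exact ENNReal.ofReal_lt_top⟩⟩
  have hμ : ∀ n, (μ n).mass ≤ C.toNNReal := fun n => by
    rw [← ENNReal.coe_le_coe, FiniteMeasure.ennreal_mass]
    change (volume.withDensity fun t => ENNReal.ofReal (g n t)) Set.univ ≤ _
    rw [hmass]
    exact ENNReal.ofReal_le_ofReal (hC n)
  obtain ⟨ν, -, hν⟩ := (isCompact_setOfPred_finiteMeasure_le_of_compactSpace Torus
    C.toNNReal).ultrafilter_le_nhds ((hyperfilter ℕ).map μ) (by
      rw [le_principal_iff]
      exact Filter.mem_map.2 (Filter.univ_mem' hμ))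
  refine ⟨ν, inferInstance, fun f hf => ?_⟩
  have ht : Tendsto μ (hyperfilter ℕ) (𝓝 ν) := hν
  have h := FiniteMeasure.tendsto_iff_forall_integral_tendsto.1 ht
    (BoundedContinuousFunction.mkOfCompact ⟨f, hf⟩)
  refine h.congr fun n => ?_
  change ∫ t, f t ∂(volume.withDensity fun t => ENNReal.ofReal (g n t)) = _
  rw [integral_withDensity_eq_integral_toReal_smul (by have := hg n; fun_prop)
    (ae_of_all _ fun _ => ENNReal.ofReal_lt_top)]
  refine integral_congr_ae (ae_of_all _ fun t => ?_)
  simp [ENNReal.toReal_ofReal (hg0 n t), mul_comm]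

lemma continuous_comp_ofReal_mul_torusExp {E : Type*} [TopologicalSpace E] {G : ℂ → E}
    (hG : ContinuousOn G (Metric.ball 0 1)) {r : ℝ} (hr0 : 0 ≤ r) (hr1 : r < 1) :
    Continuous fun t => G (r * torusExp t) := by
  refine hG.comp_continuous (continuous_const.mul continuous_torusExp) fun t => ?_
  rw [mem_ball_zero_iff, norm_ofReal_mul_torusExp hr0]
  exact hr1

/-- Dilating by `r < 1` makes the function regular up to the unit circle, where the Poisson formula
applies. -/
lemma re_eq_integral_poisson {G : ℂ → ℂ} (hG : DifferentiableOn ℂ G (Metric.ball 0 1)) {r : ℝ}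
    (hr0 : 0 ≤ r) (hr1 : r < 1) {z : ℂ} (hz : ‖z‖ < 1) :
    (G (r * z)).re = (2 * Real.pi)⁻¹ *
      ∫ t : Torus, poissonKernel 0 z (torusExp t) * (G (r * torusExp t)).re := by
  have hmaps : ∀ w ∈ Metric.closedBall (0 : ℂ) 1, (r : ℂ) * w ∈ Metric.ball (0 : ℂ) 1 := by
    intro w hw
    rw [mem_closedBall_zero_iff] at hw
    rw [mem_ball_zero_iff, norm_mul, Complex.norm_of_nonneg hr0]
    exact lt_of_le_of_lt (mul_le_of_le_one_right hr0 hw) hr1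
  have hd : DiffContOnCl ℂ (fun w => G (r * w)) (Metric.ball 0 1) := by
    refine DifferentiableOn.diffContOnCl ?_
    rw [closure_ball _ one_ne_zero]
    exact hG.comp (by fun_prop) hmaps
  have h := hd.circleAverage_poissonKernel_smul (w := z) (by simpa using hz)
  rw [circleAverage_eq_integral_torus] at h
  simp only [Complex.ofReal_one, one_mul, Pi.smul_apply', Complex.real_smul] at h
  have hc := continuous_comp_ofReal_mul_torusExp hG.continuousOn hr0 hr1
  have hi : Integrable fun t : Torus =>
      (poissonKernel 0 z (torusExp t) : ℂ) * G (r * torusExp t) := by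
    exact integrable_of_continuous
      ((Complex.continuous_ofReal.comp (continuous_poissonKernel hz)).mul hc) volume
  rw [← h, Complex.re_ofReal_mul]
  congr 1
  have h2 := integral_re hi
  simp only [RCLike.re_to_complex] at h2
  rw [← h2]
  simp

/-- A real part of a holomorphic function on the disc which is bounded in mean is a difference of
Poisson integrals of finite measures. -/
lemma exists_poisson_representation {G : ℂ → ℂ} (hG : DifferentiableOn ℂ G (Metric.ball 0 1))
    {C : ℝ} (hC : ∀ r : ℝ, 0 ≤ r → r < 1 → ∫ t : Torus, |(G (r * torusExp t)).re| ≤ C) :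
    ∃ ν₁ ν₂ : Measure Torus, IsFiniteMeasure ν₁ ∧ IsFiniteMeasure ν₂ ∧ ∀ z : ℂ, ‖z‖ < 1 →
      (G z).re = ∫ t, poissonKernel 0 z (torusExp t) ∂ν₁ -
        ∫ t, poissonKernel 0 z (torusExp t) ∂ν₂ := by
  let r : ℕ → ℝ := fun n => 1 - 1 / ((n : ℝ) + 1)
  have hr0 : ∀ n, 0 ≤ r n := fun n => by
    have : 1 / ((n : ℝ) + 1) ≤ 1 := by rw [div_le_one (by positivity)]; linarith [n.cast_nonneg (α := ℝ)]
    simp only [r]; linarith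
  have hr1 : ∀ n, r n < 1 := fun n => by
    have : 0 < 1 / ((n : ℝ) + 1) := by positivity
    simp only [r]; linarith
  have hrlim : Tendsto r (hyperfilter ℕ) (𝓝 1) := by
    have : Tendsto r atTop (𝓝 1) := by
      simpa [r] using (tendsto_one_div_add_atTop_nhds_zero_nat (𝕜 := ℝ)).const_sub 1
    exact this.mono_left Nat.hyperfilter_le_atTop
  let u : ℕ → Torus → ℝ := fun n t => (2 * Real.pi)⁻¹ * (G (r n * torusExp t)).re
  have hpi : 0 ≤ (2 * Real.pi)⁻¹ := inv_nonneg.2 Real.two_pi_pos.le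
  have hu : ∀ n, Continuous (u n) := fun n => continuous_const.mul
    (Complex.continuous_re.comp (continuous_comp_ofReal_mul_torusExp hG.continuousOn (hr0 n) (hr1 n)))
  have huC : ∀ n, ∫ t, |u n t| ≤ (2 * Real.pi)⁻¹ * C := fun n => by
    simp only [u, abs_mul, abs_of_nonneg hpi]
    rw [integral_const_mul]
    exact mul_le_mul_of_nonneg_left (hC _ (hr0 n) (hr1 n)) hpi
  have habs : ∀ n, Integrable fun t => |u n t| := fun n =>
    integrable_of_continuous (hu n).abs volume
  have hpos : ∀ n, Continuous fun t => max (u n t) 0 := fun n => (hu n).max continuous_const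
  have hneg : ∀ n, Continuous fun t => max (-u n t) 0 := fun n => (hu n).neg.max continuous_const
  -- The measures are weak limits, along the same ultrafilter, of the positive and negative parts of
  -- the boundary densities on circles of radius `r n → 1`.
  obtain ⟨ν₁, hν₁, h₁⟩ := exists_tendsto_integral_of_bounded (g := fun n t => max (u n t) 0) hpos
    (fun n t => le_max_right _ _) (fun n => (integral_mono (integrable_of_continuous (hpos n) volume)
      (habs n) fun t => max_le (le_abs_self _) (abs_nonneg _)).trans (huC n))
  obtain ⟨ν₂, hν₂, h₂⟩ := exists_tendsto_integral_of_bounded (g := fun n t => max (-u n t) 0) hneg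
    (fun n t => le_max_right _ _) (fun n => (integral_mono (integrable_of_continuous (hneg n) volume)
      (habs n) fun t => max_le (neg_le_abs _) (abs_nonneg _)).trans (huC n))
  refine ⟨ν₁, ν₂, hν₁, hν₂, fun z hz => ?_⟩
  have hP := continuous_poissonKernel hz
  have hlim := (h₁ _ hP).sub (h₂ _ hP)
  refine tendsto_nhds_unique (f := fun n => (G (r n * z)).re) (l := (hyperfilter ℕ : Filter ℕ)) ?_
    (hlim.congr fun n => ?_)
  · have hGz : ContinuousAt G z :=
      hG.continuousOn.continuousAt (Metric.isOpen_ball.mem_nhds (by simpa using hz))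
    have hrz : Tendsto (fun n => (r n : ℂ) * z) (hyperfilter ℕ) (𝓝 z) := by
      have := ((Complex.continuous_ofReal.tendsto 1).comp hrlim).mul_const z
      simpa using this
    exact (Complex.continuous_re.tendsto _).comp (hGz.tendsto.comp hrz)
  · have := hpos n
    have := hneg n
    rw [re_eq_integral_poisson hG (hr0 n) (hr1 n) hz, ← integral_sub
      (integrable_of_continuous (by fun_prop) volume)
      (integrable_of_continuous (by fun_prop) volume), ← integral_const_mul]
    refine integral_congr_ae (ae_of_all _ fun t => ?_)
    have hm : max (u n t) 0 - max (-u n t) 0 = u n t := by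
      rcases le_total (u n t) 0 with h | h
      · rw [max_eq_right h, max_eq_left (neg_nonneg.2 h)]; ring
      · rw [max_eq_left h, max_eq_right (neg_nonpos.2 h)]; ring
    simp only
    rw [← mul_sub, hm]
    simp only [u]
    ring

lemma ae_tendsto_re_of_poisson {G : ℂ → ℂ} {ν₁ ν₂ : Measure Torus} [IsFiniteMeasure ν₁]
    [IsFiniteMeasure ν₂] (hG : ∀ z : ℂ, ‖z‖ < 1 → (G z).re =
      ∫ t, poissonKernel 0 z (torusExp t) ∂ν₁ - ∫ t, poissonKernel 0 z (torusExp t) ∂ν₂) :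
    ∀ᵐ x ∂(volume : Measure Torus), Tendsto (fun r : ℝ => (G (r * torusExp x)).re) (𝓝[<] 1)
      (𝓝 (2 * Real.pi * (ν₁.rnDeriv volume x).toReal - 2 * Real.pi * (ν₂.rnDeriv volume x).toReal)) := by
  filter_upwards [ae_tendsto_poisson ν₁, ae_tendsto_poisson ν₂] with x h₁ h₂
  refine (h₁.sub h₂).congr' ?_
  filter_upwards [Ioo_mem_nhdsLT one_pos] with r hr
  rw [hG]
  rw [norm_ofReal_mul_torusExp hr.1.le]
  exact hr.2

lemma ae_exists_tendsto_re_of_bounded {F : ℂ → ℂ} (hF : DifferentiableOn ℂ F (Metric.ball 0 1))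
    (hb : ∀ z, ‖z‖ < 1 → ‖F z‖ ≤ 1) : ∀ᵐ x ∂(volume : Measure Torus),
      ∃ l : ℝ, Tendsto (fun r : ℝ => (F (r * torusExp x)).re) (𝓝[<] 1) (𝓝 l) := by
  obtain ⟨ν₁, ν₂, h₁, h₂, h⟩ := exists_poisson_representation hF
    (C := ∫ _ : Torus, (1 : ℝ)) fun r hr0 hr1 => by
      have hc := continuous_comp_ofReal_mul_torusExp hF.continuousOn hr0 hr1
      refine integral_mono (integrable_of_continuous (Complex.continuous_re.comp hc).abs volume)
        (integrable_const _) fun t => ?_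
      refine (Complex.abs_re_le_norm _).trans (hb _ ?_)
      rw [norm_ofReal_mul_torusExp hr0]
      exact hr1
  filter_upwards [ae_tendsto_re_of_poisson h] with x hx using ⟨_, hx⟩

/-- Bounded holomorphic functions have radial limits almost everywhere. -/
theorem ae_exists_tendsto_of_bounded {F : ℂ → ℂ} (hF : DifferentiableOn ℂ F (Metric.ball 0 1))
    (hb : ∀ z, ‖z‖ < 1 → ‖F z‖ ≤ 1) : ∀ᵐ x ∂(volume : Measure Torus),
      ∃ w : ℂ, Tendsto (fun r : ℝ => F (r * torusExp x)) (𝓝[<] 1) (𝓝 w) := by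
  -- The real part of `-i F` is the imaginary part of `F`.
  have hF' : DifferentiableOn ℂ (fun z => -Complex.I * F z) (Metric.ball 0 1) := hF.const_mul _
  filter_upwards [ae_exists_tendsto_re_of_bounded hF hb, ae_exists_tendsto_re_of_bounded hF'
    (fun z hz => by simpa using hb z hz)] with x ⟨a, ha⟩ ⟨b, hb⟩
  refine ⟨a + b * Complex.I, ?_⟩
  have h1 := (Complex.continuous_ofReal.tendsto a).comp ha
  have h2 := ((Complex.continuous_ofReal.tendsto b).comp hb).mul_const Complex.I
  refine (h1.add h2).congr fun r => ?_
  simp only [Function.comp_apply]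
  conv_rhs => rw [← Complex.re_add_im (F (r * torusExp x))]
  simp

/-! ### Herglotz integrals of measures -/

/-- The Herglotz integral of a measure on the circle. -/
noncomputable def herglotz (ν : Measure Torus) (z : ℂ) : ℂ :=
  ∫ t, herglotzRieszKernel 0 z (torusExp t) ∂ν

lemma continuous_herglotzKernel {z : ℂ} (hz : ‖z‖ < 1) :
    Continuous fun t => herglotzRieszKernel 0 z (torusExp t) := by
  simp only [herglotzRieszKernel, sub_zero]
  have h := continuous_torusExp
  exact Continuous.div (by fun_prop) (by fun_prop) (torusExp_ne hz)

lemma differentiableOn_herglotz (ν : Measure Torus) [IsFiniteMeasure ν] :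
    DifferentiableOn ℂ (herglotz ν) (Metric.ball 0 1) := by
  intro w hw
  have hw1 : ‖w‖ < 1 := by simpa using hw
  -- Half the distance from `w` to the circle: on the ball of radius `d` the denominator `torusExp t
  -- - z` stays at least `d` in absolute value.
  set d := (1 - ‖w‖) / 2 with hd
  have hd0 : 0 < d := by rw [hd]; linarith
  have hball : ∀ x ∈ Metric.ball w d, ‖x‖ < 1 - d := by
    intro x hx
    have h1 : ‖x‖ ≤ ‖w‖ + ‖x - w‖ := by
      have := norm_add_le w (x - w)
      simpa using this
    have h2 : ‖x - w‖ < d := by simpa [dist_eq_norm] using hx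
    linarith
  have hdist : ∀ x ∈ Metric.ball w d, ∀ t, d ≤ ‖torusExp t - x‖ := by
    intro x hx t
    have := norm_sub_norm_le (torusExp t) x
    rw [norm_torusExp] at this
    linarith [hball x hx]
  have h := continuous_torusExp
  refine (hasDerivAt_integral_of_dominated_loc_of_deriv_le
    (F := fun z t => herglotzRieszKernel 0 z (torusExp t))
    (F' := fun z t => 2 * torusExp t / (torusExp t - z) ^ 2) (bound := fun _ => 2 / d ^ 2)
    (Metric.ball_mem_nhds w hd0) ?_ ?_ ?_ ?_ ?_ ?_).2.differentiableAt.differentiableWithinAt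
  · filter_upwards [Metric.isOpen_ball.mem_nhds hw] with z hz
    exact (continuous_herglotzKernel (by simpa using hz)).aestronglyMeasurable
  · exact integrable_of_continuous (continuous_herglotzKernel hw1) ν
  · refine Continuous.aestronglyMeasurable (Continuous.div (by fun_prop) (by fun_prop) fun t => ?_)
    exact pow_ne_zero _ (torusExp_ne hw1 t)
  · refine ae_of_all _ fun t z hz => ?_
    rw [norm_div, norm_mul, norm_torusExp, mul_one, norm_pow, Complex.norm_ofNat]
    gcongr
    exact hdist z hz t
  · exact integrable_const _
  · refine ae_of_all _ fun t z hz => ?_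
    have hne : torusExp t - z ≠ 0 := norm_ne_zero_iff.1 (hd0.trans_le (hdist z hz t)).ne'
    have h₃ := ((hasDerivAt_id' z).const_add (torusExp t)).div
      ((hasDerivAt_id' z).const_sub (torusExp t)) hne
    simpa [herglotzRieszKernel_def, sub_zero, sub_sub, ← two_mul, Pi.div_def] using h₃

lemma re_herglotz (ν : Measure Torus) [IsFiniteMeasure ν] {z : ℂ} (hz : ‖z‖ < 1) :
    (herglotz ν z).re = ∫ t, poissonKernel 0 z (torusExp t) ∂ν := by
  have h := integral_re (integrable_of_continuous (continuous_herglotzKernel hz) ν)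
  simp only [RCLike.re_to_complex] at h
  rw [herglotz, ← h]
  simp only [poissonKernel_eq_re_herglotzRieszKernel, Function.comp_apply]

/-- If `F` were not constant its image would be open and would contain `F 0 + ε / 2`, whose real
part is not zero. -/
lemma eq_of_re_eq_zero {F : ℂ → ℂ} (hF : DifferentiableOn ℂ F (Metric.ball 0 1))
    (h : ∀ z, ‖z‖ < 1 → (F z).re = 0) {z : ℂ} (hz : ‖z‖ < 1) : F z = F 0 := by
  rcases (hF.analyticOnNhd Metric.isOpen_ball).is_constant_or_isOpen
    (convex_ball _ _).isPreconnected with ⟨w, hw⟩ | ho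
  · rw [hw z (by simpa using hz), hw 0 (by simp)]
  · exfalso
    have h1 := ho _ subset_rfl Metric.isOpen_ball
    obtain ⟨ε, hε, hball⟩ := Metric.isOpen_iff.1 h1 (F 0) ⟨0, by simp, rfl⟩
    have hmem : F 0 + (ε / 2 : ℝ) ∈ Metric.ball (F 0) ε := by
      rw [mem_ball_iff_norm, add_sub_cancel_left, Complex.norm_of_nonneg (by positivity)]
      linarith
    obtain ⟨v, hv, hFv⟩ := hball hmem
    have h2 := congrArg Complex.re hFv
    rw [h v (by simpa using hv), Complex.add_re, h 0 (by simp), Complex.ofReal_re] at h2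
    linarith

lemma eq_herglotz_of_poisson {G : ℂ → ℂ} (hG : DifferentiableOn ℂ G (Metric.ball 0 1))
    {ν₁ ν₂ : Measure Torus} [IsFiniteMeasure ν₁] [IsFiniteMeasure ν₂]
    (h : ∀ z : ℂ, ‖z‖ < 1 → (G z).re =
      ∫ t, poissonKernel 0 z (torusExp t) ∂ν₁ - ∫ t, poissonKernel 0 z (torusExp t) ∂ν₂) :
    ∃ c : ℂ, ∀ z, ‖z‖ < 1 → G z = c + herglotz ν₁ z - herglotz ν₂ z := by
  have hd : DifferentiableOn ℂ (fun z => G z - (herglotz ν₁ z - herglotz ν₂ z))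
      (Metric.ball 0 1) :=
    hG.sub ((differentiableOn_herglotz ν₁).sub (differentiableOn_herglotz ν₂))
  refine ⟨G 0 - (herglotz ν₁ 0 - herglotz ν₂ 0), fun z hz => ?_⟩
  have := eq_of_re_eq_zero hd (fun w hw => by
    simp only [Complex.sub_re]
    rw [h w hw, re_herglotz ν₁ hw, re_herglotz ν₂ hw, sub_self]) hz
  rw [← this]
  ring

/-! ### Almost everywhere properties on the circle -/

lemma ae_torus_iff_Ico {P : Torus → Prop} :
    (∀ᵐ x ∂(volume : Measure Torus), P x) ↔
      ∀ᵐ θ : ℝ ∂(volume.restrict (Set.Ico 0 (2 * Real.pi))), P (θ : Torus) := by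
  rw [Measure.restrict_congr_set (Ico_ae_eq_Ioc (a := (0 : ℝ)) (b := 2 * Real.pi))]
  constructor
  · intro h
    have := (AddCircle.measurePreserving_mk (2 * Real.pi) 0).quasiMeasurePreserving.ae h
    rwa [zero_add] at this
  · intro h
    have h1 : ∀ᵐ θ : Set.Ioc (0 : ℝ) (0 + 2 * Real.pi) ∂(Measure.comap Subtype.val volume),
        P ((θ : ℝ) : Torus) := by
      refine (ae_restrict_iff_subtype (μ := (volume : Measure ℝ)) (p := fun θ : ℝ => P (θ : Torus))
        (s := Set.Ioc (0 : ℝ) (0 + 2 * Real.pi)) measurableSet_Ioc).1 ?_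
      rwa [zero_add]
    have := (AddCircle.measurePreserving_equivIoc (2 * Real.pi)
      (a := 0)).quasiMeasurePreserving.ae h1
    simpa only [AddCircle.coe_equivIoc] using this

lemma ae_torus_iff_real {P : Torus → Prop} :
    (∀ᵐ x ∂(volume : Measure Torus), P x) ↔ ∀ᵐ θ : ℝ, P (θ : Torus) := by
  refine ⟨fun h => ?_, fun h => ae_torus_iff_Ico.2 (ae_restrict_of_ae h)⟩
  rw [← Measure.restrict_univ (μ := (volume : Measure ℝ)),
    ← iUnion_Ioc_add_zsmul Real.two_pi_pos 0, ae_restrict_iUnion_iff]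
  intro k
  have := (AddCircle.measurePreserving_mk (2 * Real.pi)
    (0 + k • (2 * Real.pi))).quasiMeasurePreserving.ae h
  rwa [add_assoc, ← add_one_zsmul] at this

/-- Lifted to `ℝ`, the map is `θ ↦ n * θ`, which scales Lebesgue measure by a nonzero constant. -/
lemma ae_torus_nsmul_iff {P : Torus → Prop} {n : ℕ} (hn : n ≠ 0) :
    (∀ᵐ x ∂(volume : Measure Torus), P (n • x)) ↔ ∀ᵐ x ∂(volume : Measure Torus), P x := by
  have hn' : (n : ℝ) ≠ 0 := by exact_mod_cast hn
  rw [ae_torus_iff_real, ae_torus_iff_real, ae_iff, ae_iff]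
  have := Real.volume_preimage_mul_left hn' {θ : ℝ | ¬P (θ : Torus)}
  have hset : (fun θ : ℝ => (n : ℝ) * θ) ⁻¹' {θ : ℝ | ¬P (θ : Torus)} =
      {θ : ℝ | ¬P (n • (θ : Torus))} := by
    ext θ
    simp only [Set.mem_preimage, Set.mem_ofPred_eq]
    rw [← nsmul_eq_mul, AddCircle.coe_nsmul]
  rw [hset] at this
  rw [this, mul_eq_zero, or_iff_right]
  simp [hn]

lemma ae_torus_add {P : Torus → Prop} (h : ∀ᵐ x ∂(volume : Measure Torus), P x) (y : Torus) :
    ∀ᵐ x ∂(volume : Measure Torus), P (x + y) :=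
  (measurePreserving_add_right volume y).quasiMeasurePreserving.ae h

lemma measurePreserving_nsmul_torus {n : ℕ} (hn : n ≠ 0) :
    MeasurePreserving (fun x : Torus => n • x) volume volume := by
  rcases Nat.lt_or_ge 1 n with h | h
  · exact (AddCircle.ergodic_nsmul h).toMeasurePreserving
  · have : n = 1 := by omega
    subst this
    simp only [one_smul]
    exact MeasurePreserving.id (volume : Measure Torus)

lemma exists_torusExp_eq (ζ : Circle) : ∃ y : Torus, torusExp y = ζ := by
  obtain ⟨y, hy⟩ := (AddCircle.homeomorphCircle Real.two_pi_pos.ne').surjective ζ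
  refine ⟨y, ?_⟩
  rw [← hy, AddCircle.homeomorphCircle_apply, torusExp]

/-! ### Behaviour of the operations on circles -/

lemma extend_pull (n : ℕ+) (f : O1) {z : ℂ} (hz : ‖z‖ < 1) :
    extend (toFun (pull n f)) z = extend (toFun f) (z ^ (n : ℕ)) := by
  have h1 : ‖z ^ (n : ℕ)‖ < 1 := by
    rw [norm_pow]; exact pow_lt_one₀ (norm_nonneg _) hz n.ne_zero
  rw [extend_of_lt _ hz, extend_of_lt _ h1]
  rfl

lemma extend_rot (ζ : Circle) (f : O1) {z : ℂ} (hz : ‖z‖ < 1) :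
    extend (toFun (rot ζ f)) z = extend (toFun f) (ζ * z) := by
  have h1 : ‖(ζ : ℂ) * z‖ < 1 := by rwa [norm_mul, Circle.norm_coe, one_mul]
  rw [extend_of_lt _ hz, extend_of_lt _ h1, toFun_rot]
  congr 1

lemma extend_toFun_mul (f g : O1) (z : ℂ) :
    extend (toFun (f * g)) z = extend (toFun f) z * extend (toFun g) z := by
  rw [toFun_mul, extend_mul]

lemma extend_toFun_pow (f : O1) {n : ℕ} (hn : n ≠ 0) (z : ℂ) :
    extend (toFun (f ^ n)) z = extend (toFun f) z ^ n := by
  rw [toFun_pow]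
  by_cases h : ‖z‖ < 1 <;> simp [extend, h, hn]

lemma extend_toFun_inv (f : O1) (z : ℂ) :
    extend (toFun f⁻¹) z = (extend (toFun f) z)⁻¹ := by
  rw [toFun_inv]
  by_cases h : ‖z‖ < 1 <;> simp [extend, h]

lemma tendsto_pow_nhdsLT_one {n : ℕ} (hn : n ≠ 0) :
    Tendsto (fun r : ℝ => r ^ n) (𝓝[<] 1) (𝓝[<] 1) := by
  refine tendsto_nhdsWithin_iff.2 ⟨?_, ?_⟩
  · have : ContinuousAt (fun r : ℝ => r ^ n) 1 := by fun_prop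
    have h := this.tendsto.mono_left (nhdsWithin_le_nhds (s := Set.Iio 1))
    rwa [one_pow] at h
  · filter_upwards [Ioo_mem_nhdsLT one_pos] with r hr
    exact pow_lt_one₀ hr.1.le hr.2 hn

lemma tendsto_root_nhdsLT_one {n : ℕ} (hn : n ≠ 0) :
    Tendsto (fun r : ℝ => r ^ (n : ℝ)⁻¹) (𝓝[<] 1) (𝓝[<] 1) := by
  refine tendsto_nhdsWithin_iff.2 ⟨?_, ?_⟩
  · have : ContinuousAt (fun r : ℝ => r ^ (n : ℝ)⁻¹) 1 :=
      Real.continuousAt_rpow_const _ _ (Or.inl one_ne_zero)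
    have h := this.tendsto.mono_left (nhdsWithin_le_nhds (s := Set.Iio 1))
    rwa [Real.one_rpow] at h
  · filter_upwards [Ioo_mem_nhdsLT one_pos] with r hr
    exact Real.rpow_lt_one hr.1.le hr.2 (by positivity)

/-! ### Multiples of singular inner functions -/

/-- `f` has a limit `C` in absolute value along almost every radius, and `|f| ≤ C`. -/
def IsSingularWith (f : O1) (C : ℝ) : Prop :=
  (∀ z, ‖toFun f z‖ ≤ C) ∧ ∀ᵐ x ∂(volume : Measure Torus),
    Tendsto (fun r : ℝ => ‖extend (toFun f) (r * torusExp x)‖) (𝓝[<] 1) (𝓝 C)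

lemma IsSingularWith.one_le {f : O1} {C : ℝ} (h : IsSingularWith f C) : 1 ≤ C := by
  have := h.1 0
  rwa [toFun_zero, norm_one] at this

lemma isSingularWith_one : IsSingularWith 1 1 := by
  refine ⟨fun z => by simp [toFun_one], ae_of_all _ fun x => ?_⟩
  refine tendsto_const_nhds.congr' ?_
  filter_upwards [Ioo_mem_nhdsLT one_pos] with r hr
  have : ‖(r : ℂ) * torusExp x‖ < 1 := by rw [norm_ofReal_mul_torusExp hr.1.le]; exact hr.2
  rw [extend_of_lt _ this, toFun_one, norm_one]

lemma IsSingularWith.mul {f g : O1} {C D : ℝ} (hf : IsSingularWith f C)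
    (hg : IsSingularWith g D) : IsSingularWith (f * g) (C * D) := by
  refine ⟨fun z => ?_, ?_⟩
  · rw [toFun_mul, norm_mul]
    exact mul_le_mul (hf.1 z) (hg.1 z) (norm_nonneg _) ((norm_nonneg _).trans (hf.1 z))
  · filter_upwards [hf.2, hg.2] with x h1 h2
    simp only [extend_toFun_mul, norm_mul]
    exact h1.mul h2

lemma IsSingularWith.rot {f : O1} {C : ℝ} (hf : IsSingularWith f C) (ζ : Circle) :
    IsSingularWith (rot ζ f) C := by
  refine ⟨fun z => hf.1 _, ?_⟩
  obtain ⟨y, hy⟩ := exists_torusExp_eq ζ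
  filter_upwards [ae_torus_add hf.2 y] with x hx
  refine hx.congr' ?_
  filter_upwards [Ioo_mem_nhdsLT one_pos] with r hr
  rw [extend_rot ζ f (by rw [norm_ofReal_mul_torusExp hr.1.le]; exact hr.2), torusExp_add, hy]
  congr 2
  ring

/-- The map `z ↦ z ^ n` carries the radius at `x` to the radius at `n • x`, and both `r ^ n` and `r
^ (1 / n)` tend to `1` from below. -/
lemma isSingularWith_pull_iff (n : ℕ+) {f : O1} {C : ℝ} :
    IsSingularWith (pull n f) C ↔ IsSingularWith f C := by
  refine and_congr ⟨fun h z => ?_, fun h z => h _⟩ ?_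
  · obtain ⟨w, rfl⟩ := exists_pow_eq_disc n z
    exact h w
  · rw [← ae_torus_nsmul_iff (P := fun x => Tendsto (fun r : ℝ =>
      ‖extend (toFun f) (r * torusExp x)‖) (𝓝[<] 1) (𝓝 C)) n.ne_zero]
    refine eventually_congr (ae_of_all _ fun x => ?_)
    have heq : ∀ r : ℝ, 0 < r → r < 1 → ‖extend (toFun (pull n f)) (r * torusExp x)‖ =
        ‖extend (toFun f) ((r ^ (n : ℕ) : ℝ) * torusExp ((n : ℕ) • x))‖ := fun r hr0 hr1 => by
      rw [extend_pull n f (by rw [norm_ofReal_mul_torusExp hr0.le]; exact hr1), mul_pow,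
        torusExp_nsmul, Complex.ofReal_pow]
    constructor
    · intro h
      refine (h.comp (tendsto_root_nhdsLT_one n.ne_zero)).congr' ?_
      filter_upwards [Ioo_mem_nhdsLT one_pos, tendsto_root_nhdsLT_one n.ne_zero
        (Ioo_mem_nhdsLT one_pos)] with r hr hr'
      rw [Function.comp_apply, heq _ hr'.1 hr'.2, Real.rpow_inv_natCast_pow hr.1.le n.ne_zero]
    · intro h
      refine (h.comp (tendsto_pow_nhdsLT_one n.ne_zero)).congr' ?_
      filter_upwards [Ioo_mem_nhdsLT one_pos] with r hr
      rw [Function.comp_apply, heq r hr.1 hr.2]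

lemma isSingularWith_of_pow {f : O1} {C : ℝ} {n : ℕ} (hn : n ≠ 0)
    (hf : IsSingularWith (f ^ n) C) : IsSingularWith f (C ^ (n : ℝ)⁻¹) := by
  refine ⟨fun z => ?_, ?_⟩
  · rw [Real.le_rpow_inv_iff_of_pos (norm_nonneg _) (zero_le_one.trans hf.one_le)
      (by positivity), Real.rpow_natCast, ← norm_pow]
    have := hf.1 z
    rwa [toFun_pow] at this
  · filter_upwards [hf.2] with x hx
    have hC : C ≠ 0 := (lt_of_lt_of_le one_pos hf.one_le).ne'
    refine ((Real.continuousAt_rpow_const C (n : ℝ)⁻¹ (Or.inl hC)).tendsto.comp hx).congr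
      fun r => ?_
    rw [Function.comp_apply, extend_toFun_pow f hn, norm_pow,
      Real.pow_rpow_inv_natCast (norm_nonneg _) hn]

lemma isSingularWith_prod {ι : Type*} (s : Finset ι) {f : ι → O1}
    (h : ∀ i ∈ s, ∃ C, IsSingularWith (f i) C) : ∃ C, IsSingularWith (∏ i ∈ s, f i) C :=
  Finset.prod_induction f (fun g => ∃ C, IsSingularWith g C)
    (fun _ _ ⟨_, ha⟩ ⟨_, hb⟩ => ⟨_, ha.mul hb⟩) ⟨_, isSingularWith_one⟩ h

lemma IsSingularWith.idem {f : O1} {C : ℝ} (hf : IsSingularWith f C) (n : ℕ+) :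
    ∃ D, IsSingularWith (idem n f) D := by
  obtain ⟨D, hD⟩ : ∃ D, IsSingularWith (trace n f) D := by
    rw [trace_apply]
    exact isSingularWith_prod _ fun ζ _ => ⟨C, hf.rot ζ⟩
  rw [← idem_pow] at hD
  exact ⟨_, isSingularWith_of_pow n.ne_zero hD⟩

/-- A bounded function whose absolute value has radial limits `1` is inner. -/
lemma isInner_iff {α : 𝔻 → ℂ} : IsInner α ↔ IsHolo α ∧ (∀ z, ‖α z‖ ≤ 1) ∧
    ∀ᵐ x ∂(volume : Measure Torus),
      Tendsto (fun r : ℝ => ‖extend α (r * torusExp x)‖) (𝓝[<] 1) (𝓝 1) := by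
  refine and_congr_right fun hα => and_congr_right fun hα1 => ?_
  have hset : (∀ᵐ θ : ℝ ∂(volume.restrict (Set.Ico 0 (2 * Real.pi))),
      ∃ w : ℂ, Tendsto (fun r : ℝ => extend α (r * Complex.exp (θ * Complex.I)))
        (𝓝[<] 1) (𝓝 w) ∧ ‖w‖ = 1) ↔ ∀ᵐ x ∂(volume : Measure Torus),
      ∃ w : ℂ, Tendsto (fun r : ℝ => extend α (r * torusExp x)) (𝓝[<] 1) (𝓝 w) ∧ ‖w‖ = 1 := by
    rw [ae_torus_iff_Ico]
    simp only [torusExp_coe]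
  rw [hset]
  constructor
  · intro h
    filter_upwards [h] with x ⟨w, hw, hw1⟩
    have := hw.norm
    rwa [hw1] at this
  · intro h
    have hb : ∀ z, ‖z‖ < 1 → ‖extend α z‖ ≤ 1 := fun z hz => by
      rw [extend_of_lt α hz]
      exact hα1 _
    -- Convergence of the modulus alone gives no limit of `α`; that limit comes from Fatou's theorem
    -- for bounded functions.
    filter_upwards [h, ae_exists_tendsto_of_bounded hα hb] with x hx ⟨w, hw⟩
    exact ⟨w, hw, tendsto_nhds_unique hw.norm hx⟩

/-- Normalising `α` to the value `1` at `0` replaces the bound `1` by `C = 1 / ‖α 0‖`, and dividing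
by `C` goes back. With `C` left free, products, rotations and roots can be formed inside `O1`. -/
lemma mem_SingI_iff {f : O1} : f ∈ SingI ↔ ∃ g h : O1, (∃ C, IsSingularWith g C) ∧
    (∃ C, IsSingularWith h C) ∧ f = g / h := by
  have key : ∀ {α : 𝔻 → ℂ}, IsSingularInner α →
      ∃ g : O1, (∃ C, IsSingularWith g C) ∧ ∀ z, toFun g z = α z / α 0 := by
    rintro α ⟨hα, hα0⟩
    obtain ⟨hαh, hα1, hαr⟩ := isInner_iff.1 hα
    refine ⟨ofFun (fun z => α z / α 0) ?_ (fun z => div_ne_zero (hα0 z) (hα0 0))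
      (div_self (hα0 0)), ⟨1 / ‖α 0‖, fun z => ?_, ?_⟩, fun z => rfl⟩
    · refine isHolo_of_eq (fun z => extend α z / α 0) (DifferentiableOn.div_const hαh _)
        fun z => by rw [extend_coe]
    · rw [toFun_ofFun, norm_div]
      exact div_le_div_of_nonneg_right (hα1 z) (norm_nonneg _)
    · filter_upwards [hαr] with x hx
      refine (hx.div_const ‖α 0‖).congr fun r => ?_
      rw [toFun_ofFun]
      by_cases h : ‖(r : ℂ) * torusExp x‖ < 1 <;> simp only [extend, h, dite_true, dite_false,
        norm_div, norm_zero, zero_div]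
  constructor
  · rintro ⟨α₁, α₂, h₁, h₂, h⟩
    obtain ⟨g₁, hg₁, hz₁⟩ := key h₁
    obtain ⟨g₂, hg₂, hz₂⟩ := key h₂
    refine ⟨g₁, g₂, hg₁, hg₂, toFun_injective fun z => ?_⟩
    rw [h, div_eq_mul_inv g₁, toFun_mul, toFun_inv]
    simp only [hz₁, hz₂]
    have := h₁.2 0
    have := h₂.2 0
    have := h₂.2 z
    field_simp
  · have key' : ∀ {g : O1} {C : ℝ}, IsSingularWith g C →
        IsSingularInner fun z => toFun g z / C := by
      intro g C hg
      have hC : 0 < C := lt_of_lt_of_le one_pos hg.one_le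
      have hC' : (C : ℂ) ≠ 0 := by exact_mod_cast hC.ne'
      refine ⟨isInner_iff.2 ⟨?_, fun z => ?_, ?_⟩, fun z => div_ne_zero (toFun_ne_zero g z) hC'⟩
      · refine isHolo_of_eq (fun z => extend (toFun g) z / C)
          (DifferentiableOn.div_const (toFun_isHolo g) _) fun z => by rw [extend_coe]
      · rw [norm_div, Complex.norm_of_nonneg hC.le, div_le_one hC]
        exact hg.1 z
      · filter_upwards [hg.2] with x hx
        have := hx.div_const C
        rw [div_self hC.ne'] at this
        refine this.congr fun r => ?_
        by_cases h : ‖(r : ℂ) * torusExp x‖ < 1 <;> simp only [extend, h, dite_true, dite_false,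
          norm_div, norm_zero, zero_div, Complex.norm_of_nonneg hC.le]
    rintro ⟨g, h, ⟨C, hg⟩, ⟨D, hh⟩, rfl⟩
    have hC : (C : ℂ) ≠ 0 := by exact_mod_cast (lt_of_lt_of_le one_pos hg.one_le).ne'
    have hD : (D : ℂ) ≠ 0 := by exact_mod_cast (lt_of_lt_of_le one_pos hh.one_le).ne'
    refine ⟨_, _, key' hg, key' hh, fun z => ?_⟩
    have := toFun_ne_zero h z
    rw [div_eq_mul_inv, toFun_mul, toFun_inv]
    simp only [toFun_zero]
    field_simp

/-- For descent, write `pull n f = g / h`. Applying `idem n` fixes the left side and makes `g` and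
`h` functions of `z ^ n`, so that injectivity of `pull n` gives `f` as a quotient of their descents.
-/
lemma isAdmissible_SingI : IsAdmissible SingI := by
  refine ⟨fun n f hf => ?_, fun n f hf => ?_, fun n f hf => ?_⟩
  · obtain ⟨g, h, ⟨C, hg⟩, ⟨D, hh⟩, rfl⟩ := mem_SingI_iff.1 hf
    exact mem_SingI_iff.2 ⟨_, _, ⟨C, (isSingularWith_pull_iff n).2 hg⟩,
      ⟨D, (isSingularWith_pull_iff n).2 hh⟩, map_div _ _ _⟩
  · obtain ⟨g, h, ⟨C, hg⟩, ⟨D, hh⟩, rfl⟩ := mem_SingI_iff.1 hf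
    exact mem_SingI_iff.2 ⟨_, _, hg.idem n, hh.idem n, map_div _ _ _⟩
  · obtain ⟨g, h, ⟨C, hg⟩, ⟨D, hh⟩, hgh⟩ := mem_SingI_iff.1 hf
    obtain ⟨g', hg'⟩ := exists_pull_eq_idem n g
    obtain ⟨h', hh'⟩ := exists_pull_eq_idem n h
    obtain ⟨C', hC'⟩ := hg.idem n
    obtain ⟨D', hD'⟩ := hh.idem n
    rw [← hg', isSingularWith_pull_iff] at hC'
    rw [← hh', isSingularWith_pull_iff] at hD'
    refine mem_SingI_iff.2 ⟨g', h', ⟨_, hC'⟩, ⟨_, hD'⟩, pull_injective n ?_⟩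
    rw [map_div, hg', hh', ← map_div, ← hgh]
    refine logCoeff_injective (funext fun k => ?_)
    rw [logCoeff_idem, logCoeff_pull]
    simp only
    split_ifs <;> rfl

/-! ### The Nevanlinna class -/

lemma continuous_posLog_extend {f : 𝔻 → ℂ} (hf : IsHolo f) {r : ℝ} (hr0 : 0 ≤ r) (hr1 : r < 1) :
    Continuous fun t => Real.posLog ‖extend f (r * torusExp t)‖ :=
  Real.continuous_posLog.comp (continuous_comp_ofReal_mul_torusExp hf.continuousOn hr0 hr1).norm

lemma isNevanlinna_toFun_iff {f : O1} : IsNevanlinna (toFun f) ↔ ∃ C : ℝ, ∀ r : ℝ, 0 ≤ r → r < 1 →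
    ∫ t : Torus, Real.posLog ‖extend (toFun f) (r * torusExp t)‖ ≤ C := by
  have hpi := Real.two_pi_pos
  constructor
  · rintro ⟨-, C, hC⟩
    refine ⟨2 * Real.pi * C, fun r hr0 hr1 => ?_⟩
    have := hC r hr0 hr1
    rw [circleAverage_eq_integral_torus, smul_eq_mul, inv_mul_le_iff₀ hpi] at this
    exact this
  · rintro ⟨C, hC⟩
    refine ⟨toFun_isHolo f, (2 * Real.pi)⁻¹ * C, fun r hr0 hr1 => ?_⟩
    rw [circleAverage_eq_integral_torus, smul_eq_mul]
    exact mul_le_mul_of_nonneg_left (hC r hr0 hr1) (inv_nonneg.2 hpi.le)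

lemma integral_posLog_pull (n : ℕ+) (f : O1) {r : ℝ} (hr0 : 0 ≤ r) (hr1 : r < 1) :
    ∫ t : Torus, Real.posLog ‖extend (toFun (pull n f)) (r * torusExp t)‖ =
      ∫ t : Torus, Real.posLog ‖extend (toFun f) ((r ^ (n : ℕ) : ℝ) * torusExp t)‖ := by
  have hmp := measurePreserving_nsmul_torus n.ne_zero
  have hc := continuous_posLog_extend (toFun_isHolo f) (pow_nonneg hr0 n)
    (pow_lt_one₀ hr0 hr1 n.ne_zero)
  conv_rhs => rw [← hmp.map_eq]
  rw [integral_map hmp.measurable.aemeasurable hc.aestronglyMeasurable]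
  refine integral_congr_ae (ae_of_all _ fun t => ?_)
  simp only
  rw [extend_pull n f (by rwa [norm_ofReal_mul_torusExp hr0]), mul_pow, torusExp_nsmul,
    Complex.ofReal_pow]

lemma isNevanlinna_pull_iff (n : ℕ+) {f : O1} :
    IsNevanlinna (toFun (pull n f)) ↔ IsNevanlinna (toFun f) := by
  rw [isNevanlinna_toFun_iff, isNevanlinna_toFun_iff]
  refine exists_congr fun C => ⟨fun h r hr0 hr1 => ?_, fun h r hr0 hr1 => ?_⟩
  · have hn : 0 < ((n : ℕ) : ℝ)⁻¹ := inv_pos.2 (by exact_mod_cast n.pos)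
    have h0 : 0 ≤ r ^ ((n : ℕ) : ℝ)⁻¹ := Real.rpow_nonneg hr0 _
    have h1 : r ^ ((n : ℕ) : ℝ)⁻¹ < 1 := Real.rpow_lt_one hr0 hr1 hn
    have := h _ h0 h1
    rwa [integral_posLog_pull n f h0 h1, Real.rpow_inv_natCast_pow hr0 n.ne_zero] at this
  · rw [integral_posLog_pull n f hr0 hr1]
    exact h _ (pow_nonneg hr0 _) (pow_lt_one₀ hr0 hr1 n.ne_zero)

lemma isNevanlinna_rot (ζ : Circle) {f : O1} (hf : IsNevanlinna (toFun f)) :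
    IsNevanlinna (toFun (rot ζ f)) := by
  rw [isNevanlinna_toFun_iff] at hf ⊢
  obtain ⟨C, hC⟩ := hf
  obtain ⟨y, hy⟩ := exists_torusExp_eq ζ
  refine ⟨C, fun r hr0 hr1 => ?_⟩
  refine le_trans (le_of_eq ?_) (hC r hr0 hr1)
  rw [← integral_add_right_eq_self (μ := (volume : Measure Torus)) (fun t =>
    Real.posLog ‖extend (toFun f) (r * torusExp t)‖) y]
  refine integral_congr_ae (ae_of_all _ fun t => ?_)
  simp only
  rw [extend_rot ζ f (by rwa [norm_ofReal_mul_torusExp hr0]), torusExp_add, hy]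
  congr 3
  ring

lemma isNevanlinna_of_pow {n : ℕ} (hn : n ≠ 0) {f : O1} (hf : IsNevanlinna (toFun (f ^ n))) :
    IsNevanlinna (toFun f) := by
  rw [isNevanlinna_toFun_iff] at hf ⊢
  obtain ⟨C, hC⟩ := hf
  refine ⟨C, fun r hr0 hr1 => le_trans ?_ (hC r hr0 hr1)⟩
  refine integral_mono
    (integrable_of_continuous (continuous_posLog_extend (toFun_isHolo f) hr0 hr1) volume)
    (integrable_of_continuous (continuous_posLog_extend (toFun_isHolo (f ^ n)) hr0 hr1) volume)
    fun t => ?_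
  simp only
  rw [extend_toFun_pow f hn, norm_pow, Real.posLog_pow]
  exact le_mul_of_one_le_left Real.posLog_nonneg (by exact_mod_cast Nat.one_le_iff_ne_zero.2 hn)

lemma mem_N1_iff {f : O1} : f ∈ N1 ↔ IsNevanlinna (toFun f) ∧ IsNevanlinna (toFun f⁻¹) := Iff.rfl

lemma isAdmissible_N1 : IsAdmissible N1 := by
  refine ⟨fun n f hf => ?_, fun n f hf => ?_, fun n f hf => ?_⟩
  · rw [mem_N1_iff, ← map_inv, isNevanlinna_pull_iff, isNevanlinna_pull_iff]
    exact hf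
  · have h : idem n f ^ (n : ℕ) ∈ N1 := by
      rw [idem_pow, trace_apply]
      refine prod_mem fun ζ _ => ?_
      rw [mem_N1_iff, ← map_inv]
      exact ⟨isNevanlinna_rot ζ hf.1, isNevanlinna_rot ζ hf.2⟩
    rw [mem_N1_iff, ← inv_pow] at h
    exact ⟨isNevanlinna_of_pow n.ne_zero h.1, isNevanlinna_of_pow n.ne_zero h.2⟩
  · rwa [mem_N1_iff, ← map_inv, isNevanlinna_pull_iff, isNevanlinna_pull_iff] at hf

lemma exists_extend_log (f : O1) : ∃ G : ℂ → ℂ, DifferentiableOn ℂ G (Metric.ball 0 1) ∧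
    G 0 = 0 ∧ ∀ z, ‖z‖ < 1 → Complex.exp (G z) = extend (toFun f) z := by
  obtain ⟨g, hg, hg0, hgf⟩ := exists_log f
  refine ⟨extend g, hg, ?_, fun z hz => ?_⟩
  · have := extend_coe g 0
    rwa [Complex.UnitDisc.coe_zero, hg0] at this
  · rw [extend_of_lt _ hz, extend_of_lt _ hz, hgf]

/-- Mean value property of the harmonic function `log |f|`, which vanishes at `0`. -/
lemma integral_log_norm (f : O1) {r : ℝ} (hr0 : 0 ≤ r) (hr1 : r < 1) :
    ∫ t : Torus, Real.log ‖extend (toFun f) (r * torusExp t)‖ = 0 := by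
  obtain ⟨G, hG, hG0, hGf⟩ := exists_extend_log f
  have h := re_eq_integral_poisson hG hr0 hr1 (z := 0) (by simp)
  rw [mul_zero, hG0, Complex.zero_re] at h
  have h2 := (mul_eq_zero.1 h.symm).resolve_left (inv_ne_zero Real.two_pi_pos.ne')
  rw [← h2]
  refine integral_congr_ae (ae_of_all _ fun t => ?_)
  simp only
  rw [← hGf _ (by rwa [norm_ofReal_mul_torusExp hr0]), Complex.norm_exp, Real.log_exp, poissonKernel]
  simp [norm_torusExp]

/-- Since `log |f|` has mean zero on circles, `log⁺ |f⁻¹| = log⁺ |f| - log |f|` has the same mean as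
`log⁺ |f|`, which is bounded because `f` is. -/
lemma IsSingularWith.mem_N1 {f : O1} {C : ℝ} (hf : IsSingularWith f C) : f ∈ N1 := by
  have hpi := Real.two_pi_pos
  have hle : ∀ z, Real.posLog ‖extend (toFun f) z‖ ≤ Real.posLog C := by
    intro z
    refine Real.posLog_le_posLog (norm_nonneg _) ?_
    by_cases hz : ‖z‖ < 1
    · rw [extend_of_lt _ hz]; exact hf.1 _
    · simp [extend, hz, zero_le_one.trans hf.one_le]
  have hbound : ∀ r : ℝ, 0 ≤ r → r < 1 →
      ∫ t : Torus, Real.posLog ‖extend (toFun f) (r * torusExp t)‖ ≤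
        ∫ _ : Torus, Real.posLog C := fun r hr0 hr1 => integral_mono
    (integrable_of_continuous (continuous_posLog_extend (toFun_isHolo f) hr0 hr1) volume)
    (integrable_const _) fun t => hle _
  refine ⟨isNevanlinna_toFun_iff.2 ⟨_, hbound⟩, isNevanlinna_toFun_iff.2
    ⟨∫ _ : Torus, Real.posLog C, fun r hr0 hr1 => ?_⟩⟩
  · refine le_trans (le_of_eq ?_) (hbound r hr0 hr1)
    have hi := integrable_of_continuous (continuous_posLog_extend (toFun_isHolo f) hr0 hr1) volume
    have hi' := integrable_of_continuous
      (continuous_posLog_extend (toFun_isHolo f⁻¹) hr0 hr1) volume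
    have h := integral_log_norm f hr0 hr1
    simp only [← Real.posLog_sub_posLog_inv, ← norm_inv, ← extend_toFun_inv] at h
    rw [integral_sub hi hi'] at h
    linarith

lemma SingI_le_N1 : SingI ≤ N1 := by
  intro f hf
  obtain ⟨g, h, ⟨C, hg⟩, ⟨D, hh⟩, rfl⟩ := mem_SingI_iff.1 hf
  exact div_mem hg.mem_N1 hh.mem_N1

/-! ### Fourier coefficients of integrable functions on the circle -/

lemma fourier_eq_torusExp_zpow (m : ℤ) (x : Torus) : fourier m x = torusExp x ^ m := by
  rw [fourier_apply, AddCircle.toCircle_zsmul, Circle.coe_zpow, torusExp]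

lemma integrable_continuousMap_mul {h : Torus → ℂ} (hh : Integrable h) (φ : C(Torus, ℂ)) :
    Integrable fun x => φ x * h x :=
  hh.bdd_mul (c := ‖φ‖) φ.continuous.aestronglyMeasurable (ae_of_all _ φ.norm_coe_le_norm)

/-- The **Riemann-Lebesgue lemma** on the circle. -/
lemma tendsto_fourier_integral (h : Torus → ℂ) :
    Tendsto (fun m : ℤ => ∫ x : Torus, fourier m x * h x) cofinite (𝓝 0) := by
  have hpi := Real.two_pi_pos
  have hne : -(2 * Real.pi)⁻¹ ≠ 0 := neg_ne_zero.2 (inv_ne_zero hpi.ne')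
  have h1 := Real.tendsto_integral_exp_smul_cocompact
    ((Set.Ioc 0 (2 * Real.pi)).indicator fun θ : ℝ => h (θ : Torus))
  -- The lemma on `ℝ` uses the character `exp (-2πi θ w)`; the frequency `w = -m / (2π)` makes it
  -- `exp (i m θ)`.
  have h2 : Tendsto (fun m : ℤ => -(2 * Real.pi)⁻¹ * (m : ℝ)) cofinite (cocompact ℝ) :=
    ((Homeomorph.mulLeft₀ _ hne).isClosedEmbedding.tendsto_cocompact).comp
      Int.tendsto_coe_cofinite
  refine (h1.comp h2).congr fun m => ?_
  rw [Function.comp_apply, ← AddCircle.intervalIntegral_preimage (2 * Real.pi) 0, zero_add,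
    intervalIntegral.integral_of_le hpi.le, ← integral_indicator measurableSet_Ioc]
  refine integral_congr_ae (ae_of_all _ fun θ => ?_)
  simp only [Set.indicator_apply]
  split_ifs
  · rw [Circle.smul_def, Real.fourierChar_apply, smul_eq_mul, fourier_coe_apply]
    congr 2
    have : (Real.pi : ℂ) ≠ 0 := by exact_mod_cast Real.pi_ne_zero
    push_cast
    field_simp
  · simp

/-- An integrable function whose nonconstant Fourier coefficients vanish pairs with continuous
functions as a constant. -/
lemma integral_mul_of_fourier_eq_zero {h : Torus → ℂ} (hh : Integrable h)
    (h0 : ∀ m : ℤ, m ≠ 0 → ∫ x : Torus, fourier m x * h x = 0) (φ : C(Torus, ℂ)) :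
    ∫ x, φ x * h x = (2 * Real.pi : ℂ)⁻¹ * (∫ x, h x) * ∫ x, φ x := by
  have hpi : (2 * Real.pi : ℂ) ≠ 0 := by exact_mod_cast Real.two_pi_pos.ne'
  let L : (Torus → ℂ) → C(Torus, ℂ) → ℂ := fun k φ => ∫ x, φ x * k x
  have hL : ∀ k : Torus → ℂ, Integrable k → ∃ T : C(Torus, ℂ) →L[ℂ] ℂ, ∀ φ, T φ = L k φ := by
    intro k hk
    refine ⟨LinearMap.mkContinuous ⟨⟨L k, fun φ ψ => ?_⟩, fun c φ => ?_⟩ (∫ x, ‖k x‖) fun φ => ?_,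
      fun φ => rfl⟩
    · simp only [L, ContinuousMap.add_apply, add_mul]
      exact integral_add (integrable_continuousMap_mul hk φ) (integrable_continuousMap_mul hk ψ)
    · simp only [L, ContinuousMap.smul_apply, smul_eq_mul, mul_assoc, RingHom.id_apply]
      exact integral_const_mul c _
    · refine le_trans (norm_integral_le_of_norm_le (hk.norm.mul_const ‖φ‖)
        (ae_of_all _ fun x => ?_)) (integral_mul_const _ _).le
      rw [norm_mul, mul_comm]
      exact mul_le_mul_of_nonneg_left (φ.norm_coe_le_norm x) (norm_nonneg _)
  obtain ⟨T, hT⟩ := hL h hh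
  obtain ⟨U, hU⟩ := hL (fun _ => 1) (integrable_const _)
  have hTU : T = ((2 * Real.pi : ℂ)⁻¹ * ∫ x, h x) • U := by
    -- Two continuous functionals that agree on the characters are equal, since trigonometric
    -- polynomials are dense.
    refine ContinuousLinearMap.ext_on (s := Set.range fourier)
      (Submodule.dense_iff_topologicalClosure_eq_top.2 span_fourier_closure_eq_top) ?_
    rintro _ ⟨m, rfl⟩
    rw [smul_apply, hT, hU, smul_eq_mul]
    simp only [L, mul_one]
    by_cases hm : m = 0
    · subst hm
      simp only [fourier_zero, one_mul, integral_const, measureReal_def, AddCircle.measure_univ,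
        ENNReal.toReal_ofReal Real.two_pi_pos.le, Complex.real_smul, mul_one]
      push_cast
      field_simp
    · rw [h0 m hm]
      have hconst : ∫ x : Torus, (fourier m x : ℂ) = 0 := by
        have := fourierCoeff_fourier (T := 2 * Real.pi) m
        have h2 := congrFun this 0
        rw [fourierCoeff, Pi.single_eq_of_ne (Ne.symm hm)] at h2
        simp only [neg_zero, fourier_zero, one_smul] at h2
        rw [AddCircle.integral_haarAddCircle, smul_eq_zero] at h2
        exact h2.resolve_left (inv_ne_zero Real.two_pi_pos.ne')
      rw [hconst, mul_zero]
  have := congrArg (fun V : C(Torus, ℂ) →L[ℂ] ℂ => V φ) hTU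
  simp only [smul_apply, hT, hU, smul_eq_mul] at this
  simpa only [L, mul_one] using this

lemma card_finite_roots (n : ℕ+) : (((finite_roots n).toFinset.card : ℕ) : ℂ) = n := by
  have := sum_roots_pow n 0
  simpa using this

/-- Substituting `x ↦ n • x`, which preserves the measure, and then applying the functional equation
gives an average of `n` integrals of `fourier (n * m) x * h (x + y ζ)`. As `ζ ^ n = 1`, this
character is invariant under translation by `y ζ`, so the integrals coincide. -/
lemma fourier_integral_of_functional_equation {h : Torus → ℂ} (hh : Integrable h) (n : ℕ+)
    {y : Circle → Torus} (hy : ∀ ζ, torusExp (y ζ) = ζ)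
    (hfe : ∀ᵐ x ∂(volume : Measure Torus),
      (n : ℂ) * h ((n : ℕ) • x) = ∑ ζ ∈ (finite_roots n).toFinset, h (x + y ζ)) (m : ℤ) :
    ∫ x : Torus, fourier m x * h x = ∫ x : Torus, fourier ((n : ℤ) * m) x * h x := by
  have hn : ((n : ℕ) : ℂ) ≠ 0 := by exact_mod_cast n.ne_zero
  have hmp := measurePreserving_nsmul_torus n.ne_zero
  have h1 : ∫ x : Torus, fourier m x * h x =
      ∫ x : Torus, fourier ((n : ℤ) * m) x * h ((n : ℕ) • x) := by
    conv_lhs => rw [← hmp.map_eq]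
    rw [integral_map hmp.measurable.aemeasurable]
    · refine integral_congr_ae (ae_of_all _ fun x => ?_)
      simp only
      rw [fourier_eq_torusExp_zpow, fourier_eq_torusExp_zpow, torusExp_nsmul, zpow_mul,
        zpow_natCast]
    · rw [hmp.map_eq]
      exact (integrable_continuousMap_mul hh _).aestronglyMeasurable
  have hterm : ∀ ζ ∈ (finite_roots n).toFinset,
      (fun x : Torus => fourier ((n : ℤ) * m) x * h (x + y ζ)) =
        fun x => fourier ((n : ℤ) * m) (x + y ζ) * h (x + y ζ) := by
    intro ζ hζ
    have hζ' : ζ ^ (n : ℕ) = 1 := by simpa using hζ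
    have hζ'' : (ζ : ℂ) ^ (n : ℕ) = 1 := by rw [← Circle.coe_pow, hζ', Circle.coe_one]
    funext x
    rw [fourier_eq_torusExp_zpow, fourier_eq_torusExp_zpow, torusExp_add, mul_zpow, hy,
      zpow_mul (ζ : ℂ), zpow_natCast, hζ'', one_zpow, mul_one]
  have h2 : (n : ℂ) * ∫ x : Torus, fourier ((n : ℤ) * m) x * h ((n : ℕ) • x) =
      n * ∫ x : Torus, fourier ((n : ℤ) * m) x * h x := by
    rw [← integral_const_mul]
    have : ∀ᵐ x ∂(volume : Measure Torus), (n : ℂ) * (fourier ((n : ℤ) * m) x * h ((n : ℕ) • x)) =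
        ∑ ζ ∈ (finite_roots n).toFinset, fourier ((n : ℤ) * m) x * h (x + y ζ) := by
      filter_upwards [hfe] with x hx
      rw [mul_left_comm, hx, Finset.mul_sum]
    rw [integral_congr_ae this, integral_finsetSum]
    · rw [Finset.sum_congr rfl fun ζ hζ => by
        rw [hterm ζ hζ, integral_add_right_eq_self (μ := (volume : Measure Torus))
          (fun x => fourier ((n : ℤ) * m) x * h x) (y ζ)], Finset.sum_const, nsmul_eq_mul,
        card_finite_roots]
    · intro ζ hζ
      rw [hterm ζ hζ]
      exact (integrable_continuousMap_mul hh (fourier ((n : ℤ) * m))).comp_add_right (y ζ)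
  rw [h1]
  exact mul_left_cancel₀ hn h2

/-- The coefficient is the same at all the distinct frequencies `n ^ j * m`, along which it tends to
`0` by the Riemann-Lebesgue lemma. -/
lemma fourier_integral_eq_zero {h : Torus → ℂ} {n : ℕ} (hn : 2 ≤ n)
    (hfe : ∀ m : ℤ, ∫ x : Torus, fourier m x * h x = ∫ x : Torus, fourier ((n : ℤ) * m) x * h x)
    {m : ℤ} (hm : m ≠ 0) : ∫ x : Torus, fourier m x * h x = 0 := by
  have hiter : ∀ j : ℕ, ∫ x : Torus, fourier ((n : ℤ) ^ j * m) x * h x =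
      ∫ x : Torus, fourier m x * h x := by
    intro j
    induction j with
    | zero => simp
    | succ j ih => rw [← ih, hfe ((n : ℤ) ^ j * m), pow_succ', mul_assoc]
  have hinj : Function.Injective fun j : ℕ => (n : ℤ) ^ j * m := by
    intro i j hij
    have h1 : (n : ℤ) ^ i = (n : ℤ) ^ j := mul_right_cancel₀ hm hij
    exact Nat.pow_right_injective hn (by exact_mod_cast h1)
  have ht := (tendsto_fourier_integral h).comp hinj.tendsto_cofinite
  refine tendsto_nhds_unique (tendsto_const_nhds (f := (cofinite : Filter ℕ))) (ht.congr fun j => ?_)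
  exact hiter j

/-! ### Exponentials of Herglotz integrals of singular measures -/

/-- The modulus is `exp (Re H(0) - P)`, where `H` is the Herglotz integral and `P ≥ 0` the Poisson
integral of `σ`. This gives the bound `C = exp (Re H(0))`, and singularity makes the radial limits
of `P` vanish almost everywhere. -/
lemma exists_exp_herglotz {σ : Measure Torus} [IsFiniteMeasure σ]
    (hσ : σ ⟂ₘ (volume : Measure Torus)) : ∃ g : O1, (∃ C, IsSingularWith g C) ∧
      ∀ z : 𝔻, toFun g z = Complex.exp (herglotz σ 0 - herglotz σ z) := by
  have hd := differentiableOn_herglotz σ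
  have hholo : IsHolo fun z : 𝔻 => Complex.exp (herglotz σ 0 - herglotz σ z) :=
    isHolo_of_eq (fun z => Complex.exp (herglotz σ 0 - herglotz σ z))
      ((differentiableOn_const _).sub hd).cexp fun _ => rfl
  have hnorm : ∀ z : ℂ, ‖z‖ < 1 → ‖Complex.exp (herglotz σ 0 - herglotz σ z)‖ =
      Real.exp ((herglotz σ 0).re - ∫ t, poissonKernel 0 z (torusExp t) ∂σ) := fun z hz => by
    rw [Complex.norm_exp, Complex.sub_re, re_herglotz σ hz]
  refine ⟨ofFun _ hholo (fun z => Complex.exp_ne_zero _) (by simp),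
    ⟨Real.exp (herglotz σ 0).re, fun z => ?_, ?_⟩, fun z => rfl⟩
  · rw [toFun_ofFun, hnorm _ z.norm_lt_one, Real.exp_le_exp, sub_le_self_iff]
    exact integral_nonneg (poissonKernel_nonneg z.norm_lt_one)
  · filter_upwards [ae_tendsto_poisson σ, (Measure.rnDeriv_eq_zero σ volume).2 hσ] with x hx hx0
    rw [hx0, Pi.zero_apply, ENNReal.toReal_zero, mul_zero] at hx
    have h1 := (Real.continuous_exp.tendsto _).comp (hx.const_sub (herglotz σ 0).re)
    rw [sub_zero] at h1
    refine h1.congr' ?_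
    filter_upwards [Ioo_mem_nhdsLT one_pos] with r hr
    have hr1 : ‖(r : ℂ) * torusExp x‖ < 1 := by
      rw [norm_ofReal_mul_torusExp hr.1.le]; exact hr.2
    rw [Function.comp_apply, extend_of_lt _ hr1, toFun_ofFun, Complex.UnitDisc.coe_mk, hnorm _ hr1]

lemma mem_SingI_of_poisson {f : O1} {G : ℂ → ℂ} (hG : DifferentiableOn ℂ G (Metric.ball 0 1))
    (hG0 : G 0 = 0) (hGf : ∀ z, ‖z‖ < 1 → Complex.exp (G z) = extend (toFun f) z)
    {σ₁ σ₂ : Measure Torus} [IsFiniteMeasure σ₁] [IsFiniteMeasure σ₂]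
    (h₁ : σ₁ ⟂ₘ (volume : Measure Torus)) (h₂ : σ₂ ⟂ₘ (volume : Measure Torus)) {c : ℝ}
    (h : ∀ z : ℂ, ‖z‖ < 1 → (G z).re = c + (∫ t, poissonKernel 0 z (torusExp t) ∂σ₁ -
      ∫ t, poissonKernel 0 z (torusExp t) ∂σ₂)) : f ∈ SingI := by
  obtain ⟨d, hd⟩ := eq_herglotz_of_poisson (G := fun z => G z - c) (hG.sub_const _)
    (ν₁ := σ₁) (ν₂ := σ₂) fun z hz => by
      rw [Complex.sub_re, h z hz, Complex.ofReal_re, add_sub_cancel_left]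
  obtain ⟨g₁, hg₁, hgz₁⟩ := exists_exp_herglotz h₁
  obtain ⟨g₂, hg₂, hgz₂⟩ := exists_exp_herglotz h₂
  -- The measure `σ₁` increases `log |f|` while `g₁` has exponent `H₁(0) - H₁`, so `g₁` belongs in
  -- the denominator.
  refine mem_SingI_iff.2 ⟨g₂, g₁, hg₂, hg₁, toFun_injective fun z => ?_⟩
  rw [div_eq_mul_inv, toFun_mul, toFun_inv]
  simp only
  rw [hgz₁, hgz₂, ← Complex.exp_neg, ← Complex.exp_add, ← extend_coe (toFun f) z,
    ← hGf _ z.norm_lt_one]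
  congr 1
  have e1 := hd z z.norm_lt_one
  have e2 := hd 0 (by simp)
  rw [hG0] at e2
  linear_combination e1 - e2

/-! ### Solutions of the functional equation in the Nevanlinna class -/

lemma toFun_prod {ι : Type*} (s : Finset ι) (f : ι → O1) (z : 𝔻) :
    toFun (∏ i ∈ s, f i) z = ∏ i ∈ s, toFun (f i) z := by
  classical
  induction s using Finset.induction_on with
  | empty => simp [toFun_one]
  | insert a s ha ih => rw [Finset.prod_insert ha, Finset.prod_insert ha, toFun_mul]; simp only [ih]

lemma log_norm_functional_equation {n : ℕ+} {f : O1} (hf : pull n f ^ (n : ℕ) = trace n f)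
    {z : ℂ} (hz : ‖z‖ < 1) : (n : ℝ) * Real.log ‖extend (toFun f) (z ^ (n : ℕ))‖ =
      ∑ ζ ∈ (finite_roots n).toFinset, Real.log ‖extend (toFun f) (ζ * z)‖ := by
  have h := congrArg (fun g => toFun g (Complex.UnitDisc.mk z hz)) hf
  simp only [toFun_pow, trace_apply, toFun_prod] at h
  have h2 := congrArg (fun w : ℂ => Real.log ‖w‖) h
  simp only [norm_pow, Real.log_pow, norm_prod] at h2
  rw [Real.log_prod fun ζ _ => norm_ne_zero_iff.2 (toFun_ne_zero _ _)] at h2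
  rw [← extend_pull n f hz, extend_of_lt _ hz, h2]
  refine Finset.sum_congr rfl fun ζ _ => ?_
  rw [← extend_rot ζ f hz, extend_of_lt _ hz]

lemma abs_log_eq (x : ℝ) : |Real.log x| = Real.posLog x + Real.posLog x⁻¹ := by
  have h1 := Real.half_mul_log_add_log_abs (x := x)
  have h2 := Real.half_mul_log_add_log_abs (x := x⁻¹)
  rw [Real.log_inv, abs_neg] at h2
  linarith

lemma exists_integral_abs_log_le {f : O1} (hf : f ∈ N1) : ∃ C : ℝ, ∀ r : ℝ, 0 ≤ r → r < 1 →
    ∫ t : Torus, |Real.log ‖extend (toFun f) (r * torusExp t)‖| ≤ C := by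
  obtain ⟨C, hC⟩ := isNevanlinna_toFun_iff.1 hf.1
  obtain ⟨D, hD⟩ := isNevanlinna_toFun_iff.1 hf.2
  refine ⟨C + D, fun r hr0 hr1 => ?_⟩
  have hi := integrable_of_continuous (continuous_posLog_extend (toFun_isHolo f) hr0 hr1) volume
  have hi' := integrable_of_continuous
    (continuous_posLog_extend (toFun_isHolo f⁻¹) hr0 hr1) volume
  simp only [abs_log_eq, ← norm_inv, ← extend_toFun_inv]
  rw [integral_add hi hi']
  exact add_le_add (hC r hr0 hr1) (hD r hr0 hr1)

lemma integral_poisson_eq_add (ν : Measure Torus) [IsFiniteMeasure ν] {z : ℂ} (hz : ‖z‖ < 1) :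
    ∫ t, poissonKernel 0 z (torusExp t) ∂ν =
      ∫ t, poissonKernel 0 z (torusExp t) ∂(ν.singularPart volume) +
        ∫ t, poissonKernel 0 z (torusExp t) * (ν.rnDeriv volume t).toReal := by
  have hc := continuous_poissonKernel hz
  conv_lhs => rw [Measure.haveLebesgueDecomposition_add ν volume]
  rw [integral_add_measure (integrable_of_continuous hc _) (integrable_of_continuous hc _),
    integral_withDensity_eq_integral_toReal_smul (Measure.measurable_rnDeriv _ _)
      (Measure.rnDeriv_lt_top _ _)]
  simp only [smul_eq_mul, mul_comm]

/-- A solution in the Nevanlinna class of the functional equation for a single `n ≥ 2` is a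
quotient of singular inner functions. -/
theorem mem_SingI_of_functional_equation {n : ℕ+} (hn : 2 ≤ n) {f : O1} (hfN : f ∈ N1)
    (hf : pull n f ^ (n : ℕ) = trace n f) : f ∈ SingI := by
  have hpi := Real.two_pi_pos
  obtain ⟨G, hG, hG0, hGf⟩ := exists_extend_log f
  have hGre : ∀ z, ‖z‖ < 1 → (G z).re = Real.log ‖extend (toFun f) z‖ := fun z hz => by
    rw [← hGf z hz, Complex.norm_exp, Real.log_exp]
  obtain ⟨C, hC⟩ := exists_integral_abs_log_le hfN
  obtain ⟨ν₁, ν₂, hν₁, hν₂, hν⟩ := exists_poisson_representation hG (C := C)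
    fun r hr0 hr1 => by
      refine le_trans (le_of_eq ?_) (hC r hr0 hr1)
      refine integral_congr_ae (ae_of_all _ fun t => ?_)
      simp only
      rw [hGre _ (by rwa [norm_ofReal_mul_torusExp hr0])]
  let h : Torus → ℝ := fun x => 2 * Real.pi * (ν₁.rnDeriv volume x).toReal -
    2 * Real.pi * (ν₂.rnDeriv volume x).toReal
  have hint₁ : Integrable fun x : Torus => (ν₁.rnDeriv volume x).toReal :=
    Measure.integrable_toReal_rnDeriv
  have hint₂ : Integrable fun x : Torus => (ν₂.rnDeriv volume x).toReal :=
    Measure.integrable_toReal_rnDeriv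
  have hh : Integrable h := (hint₁.const_mul _).sub (hint₂.const_mul _)
  have hhC : Integrable fun x => (h x : ℂ) := hh.ofReal
  have hlim : ∀ᵐ x ∂(volume : Measure Torus),
      Tendsto (fun r : ℝ => Real.log ‖extend (toFun f) (r * torusExp x)‖) (𝓝[<] 1) (𝓝 (h x)) := by
    filter_upwards [ae_tendsto_re_of_poisson hν] with x hx
    refine hx.congr' ?_
    filter_upwards [Ioo_mem_nhdsLT one_pos] with r hr
    rw [hGre _ (by rw [norm_ofReal_mul_torusExp hr.1.le]; exact hr.2)]
  choose y hy using exists_torusExp_eq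
  -- The logarithm of the functional equation is read along radii; `r ^ n` tends to `1` with `r`, so
  -- both sides have radial limits.
  have hfe : ∀ᵐ x ∂(volume : Measure Torus), (n : ℝ) * h ((n : ℕ) • x) =
      ∑ ζ ∈ (finite_roots n).toFinset, h (x + y ζ) := by
    have hsum : ∀ᵐ x ∂(volume : Measure Torus), ∀ ζ ∈ (finite_roots n).toFinset,
        Tendsto (fun r : ℝ => Real.log ‖extend (toFun f) (r * torusExp (x + y ζ))‖) (𝓝[<] 1)
          (𝓝 (h (x + y ζ))) :=
      (Finset.eventually_all _).2 fun ζ _ => ae_torus_add hlim (y ζ)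
    filter_upwards [(ae_torus_nsmul_iff n.ne_zero).2 hlim, hsum] with x hx hx'
    refine tendsto_nhds_unique ((hx.comp (tendsto_pow_nhdsLT_one n.ne_zero)).const_mul (n : ℝ))
      ((tendsto_finsetSum _ hx').congr' ?_)
    filter_upwards [Ioo_mem_nhdsLT one_pos] with r hr
    have := log_norm_functional_equation hf (z := r * torusExp x)
      (by rw [norm_ofReal_mul_torusExp hr.1.le]; exact hr.2)
    rw [Function.comp_apply, torusExp_nsmul, Complex.ofReal_pow, ← mul_pow, this]
    refine Finset.sum_congr rfl fun ζ _ => ?_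
    rw [torusExp_add, hy]
    congr 3
    ring
  have hzero : ∀ m : ℤ, m ≠ 0 → ∫ x : Torus, fourier m x * (h x : ℂ) = 0 := fun m hm =>
    fourier_integral_eq_zero (n := n) (by exact_mod_cast hn)
      (fun m => fourier_integral_of_functional_equation hhC n hy (by
        filter_upwards [hfe] with x hx
        exact_mod_cast hx) m) hm
  -- The constant is the mean of `h`: integrated against the Poisson kernel, the density `h / (2π)`
  -- behaves like a constant, and only the singular parts of `ν₁` and `ν₂` remain.
  refine mem_SingI_of_poisson hG hG0 hGf (Measure.mutuallySingular_singularPart ν₁ volume)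
    (Measure.mutuallySingular_singularPart ν₂ volume) (c := (2 * Real.pi)⁻¹ * ∫ x, h x) ?_
  intro z hz
  have hc := continuous_poissonKernel hz
  have hpair := integral_mul_of_fourier_eq_zero hhC hzero
    ⟨fun t => (poissonKernel 0 z (torusExp t) : ℂ), Complex.continuous_ofReal.comp hc⟩
  simp only [ContinuousMap.coe_mk, ← Complex.ofReal_mul, integral_complex_ofReal,
    integral_poissonKernel hz] at hpair
  have hpair' : ∫ t : Torus, poissonKernel 0 z (torusExp t) * h t = ∫ x, h x := by
    have h3 : (∫ t : Torus, poissonKernel 0 z (torusExp t) * h t) =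
        (2 * Real.pi)⁻¹ * (∫ x, h x) * (2 * Real.pi) := by exact_mod_cast hpair
    rw [h3]
    field_simp
  have hbdd : ∀ {k : Torus → ℝ}, Integrable k →
      Integrable fun t => poissonKernel 0 z (torusExp t) * k t := fun {k} hk =>
    hk.bdd_mul (c := ‖(⟨_, hc⟩ : C(Torus, ℝ))‖) hc.aestronglyMeasurable
      (ae_of_all _ (ContinuousMap.norm_coe_le_norm ⟨_, hc⟩))
  have hsplit : ∫ t : Torus, poissonKernel 0 z (torusExp t) * h t =
      2 * Real.pi * (∫ t, poissonKernel 0 z (torusExp t) * (ν₁.rnDeriv volume t).toReal) -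
      2 * Real.pi * ∫ t, poissonKernel 0 z (torusExp t) * (ν₂.rnDeriv volume t).toReal := by
    rw [← integral_const_mul, ← integral_const_mul, ← integral_sub ((hbdd hint₁).const_mul _)
      ((hbdd hint₂).const_mul _)]
    refine integral_congr_ae (ae_of_all _ fun t => ?_)
    simp only [h]
    ring
  rw [hν z hz, integral_poisson_eq_add ν₁ hz, integral_poisson_eq_add ν₂ hz, ← hpair', hsplit]
  field_simp
  ring

/-- The equation for one `n ≥ 2` already forces membership in `SingI`; this is where `s ≥ 1` enters.
-/
lemma H0_SingI_eq_H0_N1 {S : Submonoid ℕ+} (hS : ∃ n ∈ S, 2 ≤ n) : H0 S SingI = H0 S N1 := by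
  refine le_antisymm (fun f hf => ⟨SingI_le_N1 hf.1, hf.2⟩) fun f hf => ?_
  obtain ⟨n, hnS, hn⟩ := hS
  exact ⟨mem_SingI_of_functional_equation hn hf.1 (hf.2 n hnS), hf.2⟩

end CircleFE

theorem proposition16 {s : ℕ} (hs : 1 ≤ s) (N : Fin s → ℕ+) (hN : ∀ i, 2 ≤ N i)
    (hcop : Pairwise fun i j => (N i).Coprime (N j)) :
    -- the product defining `Ψ_S(α)` converges locally uniformly on the disc
    (∀ α : O1, HasProdLocallyUniformly (fun (n : mon N) (z : 𝔻) => toFun α (z ^ (n : ℕ+)))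
      (Psi (mon N) α)) ∧
    -- `Φ_S` and `Ψ_S` are mutually inverse isomorphisms between `H⁰(S, O¹)` and `Z(S, O¹)`
    (∃ E : H0 (mon N) ⊤ ≃* Z (mon N) ⊤,
      (∀ f, (E f : O1) = Phi N f) ∧
      ∀ (α : Z (mon N) ⊤) (z : 𝔻), toFun (E.symm α : O1) z = Psi (mon N) α z) ∧
    -- for each of the three groups, `Φ_S` is injective and `π` is an isomorphism with inverse `Ω_S`
    (∀ G ∈ ({SingI, N1, ⊤} : Set (Subgroup O1)),
      (∃ φ : H0 (mon N) G →* Z (mon N) G,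
        (∀ f, (φ f : O1) = Phi N f) ∧ Function.Injective φ) ∧
      ∃ P : Z (mon N) G ≃* G ⧸ powS (mon N) G,
        (∀ m, P m = proj (mon N) G m) ∧
        ∀ u : G, (P.symm (QuotientGroup.mk u) : O1) = Omega N u) ∧
    -- the maps induced by the inclusions, and `H⁰(S, I) = H⁰(S, N¹)`
    ∃ hle : SingI ≤ N1,
      Function.Injective (quotMap (mon N) hle) ∧
      Function.Injective (quotMap (mon N) (le_top : N1 ≤ ⊤)) ∧
      (∀ (m : Z (mon N) SingI) (m' : Z (mon N) N1), (m : O1) = m' →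
        quotMap (mon N) hle (proj (mon N) SingI m) = proj (mon N) N1 m') ∧
      (∀ (m : Z (mon N) N1) (m' : Z (mon N) ⊤), (m : O1) = m' →
        quotMap (mon N) (le_top : N1 ≤ ⊤) (proj (mon N) N1 m) = proj (mon N) ⊤ m') ∧
      H0 (mon N) SingI = H0 (mon N) N1 := by
  refine ⟨hasProdLocallyUniformly_Psi (mon N), exists_Phi_equiv hN hcop, ?_, SingI_le_N1,
    quotMap_injective hN isAdmissible_SingI SingI_le_N1,
    quotMap_injective hN isAdmissible_N1 le_top, quotMap_proj SingI_le_N1, quotMap_proj le_top,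
    H0_SingI_eq_H0_N1 ⟨N ⟨0, hs⟩, mem_mon N _, hN _⟩⟩
  rintro G (rfl | rfl | rfl)
  · exact ⟨exists_Phi_hom hN hcop isAdmissible_SingI, exists_proj_equiv hN isAdmissible_SingI⟩
  · exact ⟨exists_Phi_hom hN hcop isAdmissible_N1, exists_proj_equiv hN isAdmissible_N1⟩
  · exact ⟨exists_Phi_hom hN hcop isAdmissible_top, exists_proj_equiv hN isAdmissible_top⟩
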